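/- Let $A\in\mathbb R^{n\times n}$, $B\in\mathbb R^{n\times m}$, $\Sigma\in\mathbb R^{n\times n}$ symmetric positive definite, $x_0\in\mathbb R^n$, $T>0$, $w\in\mathbb R^n$, $a\in\mathbb R$, and let $W$ be a standard $n$-dimensional Brownian motion on a probability space. For a deterministic control $u\in L^2([0,T];\mathbb R^m)$ let $X$ solve $$dX_t=AX_t\,dt+Bu_t\,dt+\Sigma^{1/2}dW_t,\qquad X_0=x_0,$$ on $[0,T]$, and write $\mathbb P_u$ for the probability under the control $u$. Put $\Psi(t,s)=e^{A(t-s)}$, $M=B^\top\Sigma^{-1}B$, $E(u)=\tfrac12\int_0^Tu_t^\top Mu_t\,dt$, and $$V_T=\int_0^T\Psi(T,s)\,\Sigma\,\Psi(T,s)^\top ds,\qquad W_c^M=\int_0^T\Psi(T,s)\,B\,M^{+}B^\top\,\Psi(T,s)^\top ds,$$ where $M^+$ is the Moore–Penrose pseudoinverse of $M$ (so $M^+=M^{-1}$ if $M$ is invertible). Assume $w^\top W_c^Mw>0$ and put $R_T^2(w)=\dfrac{w^\top W_c^Mw}{w^\top V_Tw}$. Let $\Phi$ be the standard normal distribution function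 and $p_0=\mathbb P_{u\equiv0}(w^\top X_T\ge a)$. Then $p_0\in(0,1)$, and for every $p_1\in(0,1)$ $$\min\bigl\{E(u):\ u\in L^2([0,T];\mathbb R^m),\ \mathbb P_u(w^\top X_T\ge a)=p_1\bigr\}=\frac{\bigl(\Phi^{-1}(p_1)-\Phi^{-1}(p_0)\bigr)^2}{2R_T^2(w)},$$ and the minimum is attained by the matched-filter control $$u^*(s)=\beta\,M^{+}B^\top\Psi(T,s)^\top w,\qquad \beta=\frac{\bigl(\Phi^{-1}(p_1)-\Phi^{-1}(p_0)\bigr)\sqrt{w^\top V_Tw}}{w^\top W_c^Mw}.$$ -/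

import Mathlib

open MeasureTheory ProbabilityTheory Matrix Set
open scoped NNReal

namespace QuantileEnergy

section MoorePenrose

variable {k l : ℕ}

/-- `N` is a Moore–Penrose pseudoinverse of the real matrix `M`. -/
structure IsMoorePenrose (M : Matrix (Fin k) (Fin l) ℝ) (N : Matrix (Fin l) (Fin k) ℝ) :
    Prop where
  mul_mul_self : M * N * M = M
  self_mul_mul : N * M * N = N
  symm_left : (M * N)ᵀ = M * N
  symm_right : (N * M)ᵀ = N * M

/-- Uniqueness of the Moore–Penrose pseudoinverse. -/
theorem IsMoorePenrose.unique {M : Matrix (Fin k) (Fin l) ℝ} {N N' : Matrix (Fin l) (Fin k) ℝ}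
    (h : IsMoorePenrose M N) (h' : IsMoorePenrose M N') : N = N' := by
  have e1 : M * N = M * N' := by
    calc M * N = (M * N)ᵀ := h.symm_left.symm
      _ = ((M * N') * (M * N))ᵀ := by rw [← Matrix.mul_assoc, h'.mul_mul_self]
      _ = (M * N)ᵀ * (M * N')ᵀ := Matrix.transpose_mul _ _
      _ = (M * N) * (M * N') := by rw [h.symm_left, h'.symm_left]
      _ = M * N' := by rw [← Matrix.mul_assoc, h.mul_mul_self]
  have e2 : N * M = N' * M := by
    calc N * M = (N * M)ᵀ := h.symm_right.symm
      _ = ((N * M) * (N' * M))ᵀ := by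
        rw [Matrix.mul_assoc N M, ← Matrix.mul_assoc M N' M, h'.mul_mul_self]
      _ = (N' * M)ᵀ * (N * M)ᵀ := Matrix.transpose_mul _ _
      _ = (N' * M) * (N * M) := by rw [h.symm_right, h'.symm_right]
      _ = N' * M := by rw [Matrix.mul_assoc N' M, ← Matrix.mul_assoc M N M, h.mul_mul_self]
  calc N = N * M * N := h.self_mul_mul.symm
    _ = N' * M * N' := by rw [e2, Matrix.mul_assoc, e1, ← Matrix.mul_assoc]
    _ = N' := h'.self_mul_mul

theorem IsMoorePenrose.transpose {M : Matrix (Fin k) (Fin l) ℝ} {N : Matrix (Fin l) (Fin k) ℝ}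
    (h : IsMoorePenrose M N) : IsMoorePenrose Mᵀ Nᵀ where
  mul_mul_self := by
    have := congrArg Matrix.transpose h.mul_mul_self
    rwa [Matrix.transpose_mul, Matrix.transpose_mul, ← Matrix.mul_assoc] at this
  self_mul_mul := by
    have := congrArg Matrix.transpose h.self_mul_mul
    rwa [Matrix.transpose_mul, Matrix.transpose_mul, ← Matrix.mul_assoc] at this
  symm_left := by rw [← Matrix.transpose_mul, h.symm_right, h.symm_right]
  symm_right := by rw [← Matrix.transpose_mul, h.symm_left, h.symm_left]

theorem exists_isMoorePenrose_of_isHermitian {G : Matrix (Fin l) (Fin l) ℝ}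
    (hG : G.IsHermitian) : ∃ H, IsMoorePenrose G H := by
  have hsa : IsSelfAdjoint G := hG
  have hc : ∀ f : ℝ → ℝ, ContinuousOn f (spectrum ℝ G) := fun f =>
    (Matrix.finite_real_spectrum (A := G)).continuousOn f
  have hid : cfc (fun x : ℝ => x) G = G := cfc_id' ℝ G
  have h1 : G * cfc (fun x : ℝ => x⁻¹) G = cfc (fun x : ℝ => x * x⁻¹) G := by
    rw [cfc_mul (fun x : ℝ => x) (fun x : ℝ => x⁻¹) G (hc _) (hc _), hid]
  have h2 : cfc (fun x : ℝ => x⁻¹) G * G = cfc (fun x : ℝ => x * x⁻¹) G := by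
    rw [cfc_congr (g := fun x : ℝ => x⁻¹ * x) (fun x _ => mul_comm _ _),
      cfc_mul (fun x : ℝ => x⁻¹) (fun x : ℝ => x) G (hc _) (hc _), hid]
  have hs : (cfc (fun x : ℝ => x * x⁻¹) G)ᵀ = cfc (fun x : ℝ => x * x⁻¹) G := by
    have : IsSelfAdjoint (cfc (fun x : ℝ => x * x⁻¹) G) := cfc_predicate _ G
    simpa [IsSelfAdjoint, Matrix.star_eq_conjTranspose] using this
  refine ⟨cfc (fun x : ℝ => x⁻¹) G, ?_, ?_, ?_, ?_⟩
  · rw [h1]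
    nth_rewrite 2 [← hid]
    rw [← cfc_mul (fun x : ℝ => x * x⁻¹) (fun x : ℝ => x) G (hc _) (hc _)]
    refine (cfc_congr (fun x _ => ?_)).trans hid
    simp
  · rw [h2, ← cfc_mul (fun x : ℝ => x * x⁻¹) (fun x : ℝ => x⁻¹) G (hc _) (hc _)]
    refine cfc_congr (fun x _ => ?_)
    rcases eq_or_ne x 0 with rfl | hx
    · simp
    · simp [hx]
  · rw [h1, hs]
  · rw [h2, hs]

/-- Existence of the Moore–Penrose pseudoinverse. -/
theorem exists_isMoorePenrose (M : Matrix (Fin k) (Fin l) ℝ) : ∃ N, IsMoorePenrose M N := by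
  have hG : (Mᵀ * M).IsHermitian := by
    simp [Matrix.IsHermitian, Matrix.conjTranspose_eq_transpose_of_trivial]
  obtain ⟨H, hH⟩ := exists_isMoorePenrose_of_isHermitian hG
  have hGt : (Mᵀ * M)ᵀ = Mᵀ * M := by simp
  have hHt : Hᵀ = H := by
    refine IsMoorePenrose.unique ?_ hH
    have h := hH.transpose
    rwa [hGt] at h
  have hkey : M * H * (Mᵀ * M) = M := by
    have hd : (M * (H * (Mᵀ * M)) - M) = 0 := by
      have : (M * (H * (Mᵀ * M)) - M)ᴴ * (M * (H * (Mᵀ * M)) - M) = 0 := by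
        rw [Matrix.conjTranspose_eq_transpose_of_trivial, Matrix.transpose_sub,
          Matrix.transpose_mul, hH.symm_right, Matrix.sub_mul, Matrix.mul_sub, Matrix.mul_sub,
          Matrix.mul_assoc (H * (Mᵀ * M)) Mᵀ M, ← Matrix.mul_assoc Mᵀ M (H * (Mᵀ * M)),
          Matrix.mul_assoc (H * (Mᵀ * M)) Mᵀ, ← Matrix.mul_assoc Mᵀ M (H * (Mᵀ * M)),
          ← Matrix.mul_assoc (Mᵀ * M) H (Mᵀ * M), hH.mul_mul_self]
        simp
      exact Matrix.conjTranspose_mul_self_eq_zero.mp this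
    rw [Matrix.mul_assoc]
    exact sub_eq_zero.mp hd
  refine ⟨H * Mᵀ, ?_, ?_, ?_, ?_⟩
  · rw [← Matrix.mul_assoc, Matrix.mul_assoc (M * H), hkey]
  · have := hH.self_mul_mul
    calc H * Mᵀ * M * (H * Mᵀ) = (H * (Mᵀ * M) * H) * Mᵀ := by simp only [Matrix.mul_assoc]
      _ = H * Mᵀ := by rw [this]
  · simp only [Matrix.transpose_mul, Matrix.transpose_transpose, hHt, Matrix.mul_assoc]
  · rw [Matrix.mul_assoc, hH.symm_right]

/-- The Moore–Penrose pseudoinverse `M⁺` of a real matrix. -/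
noncomputable def pinv (M : Matrix (Fin k) (Fin l) ℝ) : Matrix (Fin l) (Fin k) ℝ :=
  Classical.choose (exists_isMoorePenrose M)

theorem pinv_spec (M : Matrix (Fin k) (Fin l) ℝ) : IsMoorePenrose M (pinv M) :=
  Classical.choose_spec (exists_isMoorePenrose M)

/-- For an invertible matrix, the pseudoinverse is the inverse. -/
theorem pinv_eq_inv {M : Matrix (Fin l) (Fin l) ℝ} (hM : IsUnit M.det) : pinv M = M⁻¹ := by
  refine (pinv_spec M).unique ⟨?_, ?_, ?_, ?_⟩ <;>
    simp [Matrix.mul_nonsing_inv M hM, Matrix.nonsing_inv_mul M hM]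

end MoorePenrose

section System

variable {n m : ℕ}

/-- The state transition matrix `Ψ(t, s) = exp ((t - s) A)`. -/
noncomputable def transition (A : Matrix (Fin n) (Fin n) ℝ) (t s : ℝ) :
    Matrix (Fin n) (Fin n) ℝ :=
  NormedSpace.exp ((t - s) • A)

/-- The effort weight `M = Bᵀ Σ⁻¹ B`. -/
noncomputable def effortWeight (B : Matrix (Fin n) (Fin m) ℝ) (Sig : Matrix (Fin n) (Fin n) ℝ) :
    Matrix (Fin m) (Fin m) ℝ :=
  Bᵀ * Sig⁻¹ * B

/-- The effort `E(u) = ½ ∫₀ᵀ uₜᵀ M uₜ dt`. -/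
noncomputable def effort (B : Matrix (Fin n) (Fin m) ℝ) (Sig : Matrix (Fin n) (Fin n) ℝ) (T : ℝ)
    (u : ℝ → Fin m → ℝ) : ℝ :=
  (1 / 2) * ∫ t in (0 : ℝ)..T, u t ⬝ᵥ (effortWeight B Sig *ᵥ u t)

/-- The terminal noise covariance `V_T = ∫₀ᵀ Ψ(T,s) Σ Ψ(T,s)ᵀ ds` (entrywise integral). -/
noncomputable def noiseCov (A Sig : Matrix (Fin n) (Fin n) ℝ) (T : ℝ) :
    Matrix (Fin n) (Fin n) ℝ :=
  Matrix.of fun i j => ∫ s in (0 : ℝ)..T, (transition A T s * Sig * (transition A T s)ᵀ) i j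

/-- The weighted controllability Gramian `W_c^M = ∫₀ᵀ Ψ(T,s) B M⁺ Bᵀ Ψ(T,s)ᵀ ds`
(entrywise integral). -/
noncomputable def gramian (A : Matrix (Fin n) (Fin n) ℝ) (B : Matrix (Fin n) (Fin m) ℝ)
    (Sig : Matrix (Fin n) (Fin n) ℝ) (T : ℝ) : Matrix (Fin n) (Fin n) ℝ :=
  Matrix.of fun i j => ∫ s in (0 : ℝ)..T,
    (transition A T s * B * pinv (effortWeight B Sig) * Bᵀ * (transition A T s)ᵀ) i j

/-- The controllability-to-noise ratio `R_T²(w) = (wᵀ W_c^M w) / (wᵀ V_T w)`. -/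
noncomputable def ratio (A : Matrix (Fin n) (Fin n) ℝ) (B : Matrix (Fin n) (Fin m) ℝ)
    (Sig : Matrix (Fin n) (Fin n) ℝ) (T : ℝ) (w : Fin n → ℝ) : ℝ :=
  (w ⬝ᵥ (gramian A B Sig T *ᵥ w)) / (w ⬝ᵥ (noiseCov A Sig T *ᵥ w))

/-- The standard normal quantile function: on `(0, 1)` it is the inverse `Φ⁻¹` of the standard
normal distribution function `Φ`. -/
noncomputable def stdNormalQuantile (p : ℝ) : ℝ :=
  sInf {x : ℝ | p ≤ cdf (gaussianReal 0 1) x}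

/-- The gain `β = (Φ⁻¹(p₁) - Φ⁻¹(p₀)) √(wᵀ V_T w) / (wᵀ W_c^M w)`. -/
noncomputable def gain (A : Matrix (Fin n) (Fin n) ℝ) (B : Matrix (Fin n) (Fin m) ℝ)
    (Sig : Matrix (Fin n) (Fin n) ℝ) (T : ℝ) (w : Fin n → ℝ) (p₀ p₁ : ℝ) : ℝ :=
  (stdNormalQuantile p₁ - stdNormalQuantile p₀) * √(w ⬝ᵥ (noiseCov A Sig T *ᵥ w)) /
    (w ⬝ᵥ (gramian A B Sig T *ᵥ w))

/-- The matched-filter control `u*(s) = β M⁺ Bᵀ Ψ(T,s)ᵀ w`. -/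
noncomputable def matchedFilter (A : Matrix (Fin n) (Fin n) ℝ) (B : Matrix (Fin n) (Fin m) ℝ)
    (Sig : Matrix (Fin n) (Fin n) ℝ) (T : ℝ) (w : Fin n → ℝ) (p₀ p₁ : ℝ) : ℝ → Fin m → ℝ :=
  fun s => gain A B Sig T w p₀ p₁ •
    ((pinv (effortWeight B Sig) * Bᵀ * (transition A T s)ᵀ) *ᵥ w)

variable {Ω : Type*} [MeasurableSpace Ω]

/-- `W` is a standard `n`-dimensional Brownian motion under `P`: its coordinates are independent
standard real Brownian motions. -/
structure IsBrownianVec (W : Fin n → ℝ≥0 → Ω → ℝ) (P : Measure Ω) : Prop where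
  isBrownian : ∀ i, IsBrownianReal (W i) P
  indep : iIndepFun (fun i ω t => W i t ω) P

open scoped MatrixOrder in
/-- `X` solves `dX = A X dt + B u dt + Σ^{1/2} dW`, `X₀ = x₀`, on `[0, T]` for the deterministic
control `u`: it has almost surely continuous paths, and almost surely
`X_t = x₀ + ∫₀ᵗ (A X_s + B u_s) ds + Σ^{1/2} W_t` for all `t ∈ [0, T]`. The diffusion coefficient
is constant, so that its stochastic integral is `Σ^{1/2} W_t`. -/
structure IsSolution (A : Matrix (Fin n) (Fin n) ℝ) (B : Matrix (Fin n) (Fin m) ℝ)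
    (Sig : Matrix (Fin n) (Fin n) ℝ) (x₀ : Fin n → ℝ) (T : ℝ)
    (W : Fin n → ℝ≥0 → Ω → ℝ) (P : Measure Ω) (u : ℝ → Fin m → ℝ) (X : ℝ → Ω → Fin n → ℝ) :
    Prop where
  aemeasurable : ∀ t ∈ Icc 0 T, AEMeasurable (X t) P
  continuousOn : ∀ᵐ ω ∂P, ContinuousOn (fun t => X t ω) (Icc 0 T)
  integral_eq : ∀ᵐ ω ∂P, ∀ t ∈ Icc 0 T,
    X t ω = x₀ + (∫ s in (0 : ℝ)..t, (A *ᵥ X s ω + B *ᵥ u s)) +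
      CFC.sqrt Sig *ᵥ (fun j => W j t.toNNReal ω)

/-- Under the control `u` the terminal halfspace event `{wᵀ X_T ≥ a}` has probability `p`: the
controlled equation has a solution, and the event has probability `p` for each of its solutions. -/
def HalfspaceProb (A : Matrix (Fin n) (Fin n) ℝ) (B : Matrix (Fin n) (Fin m) ℝ)
    (Sig : Matrix (Fin n) (Fin n) ℝ) (x₀ : Fin n → ℝ) (T : ℝ)
    (W : Fin n → ℝ≥0 → Ω → ℝ) (P : Measure Ω) (w : Fin n → ℝ) (a : ℝ)
    (u : ℝ → Fin m → ℝ) (p : ℝ) : Prop :=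
  (∃ X, IsSolution A B Sig x₀ T W P u X) ∧
    ∀ X, IsSolution A B Sig x₀ T W P u X → P.real {ω | a ≤ w ⬝ᵥ X T ω} = p

/-- The controls `u ∈ L²([0,T]; ℝᵐ)` under which `{wᵀ X_T ≥ a}` has probability `p`. -/
def feasible (A : Matrix (Fin n) (Fin n) ℝ) (B : Matrix (Fin n) (Fin m) ℝ)
    (Sig : Matrix (Fin n) (Fin n) ℝ) (x₀ : Fin n → ℝ) (T : ℝ)
    (W : Fin n → ℝ≥0 → Ω → ℝ) (P : Measure Ω) (w : Fin n → ℝ) (a : ℝ) (p : ℝ) :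
    Set (ℝ → Fin m → ℝ) :=
  {u | MemLp u 2 (volume.restrict (Icc 0 T)) ∧ HalfspaceProb A B Sig x₀ T W P w a u p}

end System

end QuantileEnergy

/-! Variation of constants splits `wᵀ X_T` into the uncontrolled mean, the linear functional `L(u) =
∫ ⟨Bᵀ Ψ(T,s)ᵀ w, u s⟩ ds`, and a centered Gaussian variable of variance `v = wᵀ V_T w` that does not
depend on `u`. A control therefore acts on the halfspace probability only by translating a Gaussian,
and prescribing that probability is the single linear equation `L(u) = (Φ⁻¹(p₁) - Φ⁻¹(p₀)) √v`
(`halfspaceProb_iff`).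

What remains is to minimize a semidefinite quadratic form on an affine hyperplane. With `G = wᵀ
W_c^M w` and `d = β M⁺ Bᵀ Ψ(T,·)ᵀ w`, expanding `E(u - d) ≥ 0` gives `E(u) ≥ β L(u) - β² G / 2`,
with equality at `u = d` (`mul_meanShift_sub_le_effort`). Although `M` may be singular, `M M⁺ Bᵀ =
Bᵀ` (`effortWeight_mul_pinv_mul_transpose`), so the cross term is exactly `β L(u)`. The gain `β` is
the one for which `d` satisfies the constraint, `L(d) = β G`.

The Gaussian law needs no stochastic calculus. The integrands are `C¹`, so Wiener integrals are
defined pathwise by parts and are almost sure limits of weighted sums of independent increments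
(`hasLaw_sum_wienerIntegral`); `terminalNoise_eq` recognizes the noise in `wᵀ X_T` as such a sum of
integrals. -/

namespace QuantileEnergy

open Filter Topology

/-! ### Riemann sums and the Gaussian law of Wiener integrals -/

/-- The `i`-th point of the uniform partition of `[0, T]` into `N` pieces. -/
noncomputable def gridPt (T : ℝ) (N i : ℕ) : ℝ := i * (T / N)

theorem gridPt_zero (T : ℝ) (N : ℕ) : gridPt T N 0 = 0 := by simp [gridPt]

theorem gridPt_self (T : ℝ) {N : ℕ} (hN : N ≠ 0) : gridPt T N N = T := by
  have : (N : ℝ) ≠ 0 := by exact_mod_cast hN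
  simp only [gridPt]
  field_simp

theorem gridPt_succ_sub (T : ℝ) (N i : ℕ) : gridPt T N (i + 1) - gridPt T N i = T / N := by
  simp only [gridPt]
  push_cast
  ring

theorem monotone_gridPt {T : ℝ} (hT : 0 ≤ T) (N : ℕ) : Monotone (gridPt T N) := by
  intro i j hij
  have : (i : ℝ) ≤ j := by exact_mod_cast hij
  simp only [gridPt]
  gcongr

theorem gridPt_nonneg {T : ℝ} (hT : 0 ≤ T) (N i : ℕ) : 0 ≤ gridPt T N i := by
  simp only [gridPt]
  positivity

theorem gridPt_le {T : ℝ} (hT : 0 ≤ T) {N i : ℕ} (hN : N ≠ 0) (hi : i ≤ N) : gridPt T N i ≤ T :=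
  (monotone_gridPt hT N hi).trans (gridPt_self T hN).le

/-- Riemann sums of a continuous function against an integrable density converge. -/
theorem tendsto_sum_mul_integral {f g : ℝ → ℝ} {T : ℝ} (hT : 0 ≤ T) (hf : Continuous f)
    (hg : IntervalIntegrable g volume 0 T) {τ : ℕ → ℕ → ℝ}
    (hτ : ∀ N i, τ N i ∈ Icc (gridPt T N i) (gridPt T N (i + 1))) :
    Tendsto (fun N => ∑ i ∈ Finset.range N,
        f (τ N i) * ∫ s in gridPt T N i..gridPt T N (i + 1), g s) atTop
      (𝓝 (∫ s in (0 : ℝ)..T, f s * g s)) := by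
  have huc : UniformContinuousOn f (Icc 0 T) :=
    isCompact_Icc.uniformContinuousOn_of_continuous hf.continuousOn
  set I : ℝ := ∫ s in (0 : ℝ)..T, |g s|
  have hI : 0 ≤ I := intervalIntegral.integral_nonneg hT fun _ _ => abs_nonneg _
  rw [Metric.tendsto_atTop]
  intro ε hε
  -- The total error is at most the oscillation of `f` on a cell times `I = ∫ |g|`; the `+ 1` covers
  -- `I = 0` and makes the final inequality strict.
  obtain ⟨δ, hδ, hfd⟩ := Metric.uniformContinuousOn_iff.1 huc (ε / (I + 1)) (by positivity)
  obtain ⟨N₀, hN₀⟩ := exists_nat_gt (T / δ)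
  refine ⟨max N₀ 1, fun N hN => ?_⟩
  have hN1 : 1 ≤ N := (le_max_right _ _).trans hN
  have hNne : N ≠ 0 := by omega
  have hNpos : (0 : ℝ) < N := by exact_mod_cast hN1
  have hmesh : T / N < δ := by
    have : (N₀ : ℝ) ≤ N := by exact_mod_cast (le_max_left _ _).trans hN
    rw [div_lt_iff₀ hNpos]
    rw [div_lt_iff₀ hδ] at hN₀
    nlinarith
  have hsub : ∀ i < N, uIcc (gridPt T N i) (gridPt T N (i + 1)) ⊆ uIcc 0 T := by
    intro i hi
    rw [uIcc_of_le (monotone_gridPt hT N i.le_succ), uIcc_of_le hT]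
    exact Icc_subset_Icc (gridPt_nonneg hT N i) (gridPt_le hT hNne hi)
  have hgi : ∀ i < N, IntervalIntegrable g volume (gridPt T N i) (gridPt T N (i + 1)) :=
    fun i hi => hg.mono_set (hsub i hi)
  have hfgi : ∀ i < N, IntervalIntegrable (fun s => f s * g s) volume
      (gridPt T N i) (gridPt T N (i + 1)) :=
    fun i hi => (hgi i hi).continuousOn_mul hf.continuousOn
  have hsplit : ∀ h : ℝ → ℝ, (∀ i < N, IntervalIntegrable h volume
      (gridPt T N i) (gridPt T N (i + 1))) →
      ∫ s in (0 : ℝ)..T, h s =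
        ∑ i ∈ Finset.range N, ∫ s in gridPt T N i..gridPt T N (i + 1), h s := by
    intro h hh
    rw [intervalIntegral.sum_integral_adjacent_intervals hh, gridPt_zero, gridPt_self T hNne]
  rw [hsplit _ hfgi, dist_eq_norm, ← Finset.sum_sub_distrib]
  have hterm : ∀ i ∈ Finset.range N,
      ‖f (τ N i) * (∫ s in gridPt T N i..gridPt T N (i + 1), g s) -
        ∫ s in gridPt T N i..gridPt T N (i + 1), f s * g s‖ ≤
      ε / (I + 1) * ∫ s in gridPt T N i..gridPt T N (i + 1), |g s| := by
    intro i hi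
    have hi' := Finset.mem_range.1 hi
    have hle := monotone_gridPt hT N i.le_succ
    rw [← intervalIntegral.integral_const_mul, ← intervalIntegral.integral_const_mul,
      ← intervalIntegral.integral_sub ((hgi i hi').const_mul _) (hfgi i hi')]
    refine intervalIntegral.norm_integral_le_of_norm_le hle (ae_of_all _ fun s hs => ?_)
      ((hgi i hi').abs.const_mul _)
    rw [← sub_mul, norm_mul, Real.norm_eq_abs (g s)]
    gcongr
    have hτi := hτ N i
    have hmem : ∀ x ∈ Icc (gridPt T N i) (gridPt T N (i + 1)), x ∈ Icc 0 T := fun x hx =>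
      ⟨(gridPt_nonneg hT N i).trans hx.1, hx.2.trans (gridPt_le hT hNne hi')⟩
    have hd : dist (τ N i) s < δ := by
      rw [Real.dist_eq, abs_lt]
      have := gridPt_succ_sub T N i
      constructor <;> linarith [hs.1, hs.2, hτi.1, hτi.2]
    have := hfd _ (hmem _ hτi) _ (hmem _ (Ioc_subset_Icc_self hs)) hd
    rw [dist_eq_norm] at this
    exact this.le
  calc _ ≤ ∑ i ∈ Finset.range N,
        ε / (I + 1) * ∫ s in gridPt T N i..gridPt T N (i + 1), |g s| :=
        norm_sum_le_of_le _ hterm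
    _ = ε / (I + 1) * I := by
        rw [← Finset.mul_sum, ← hsplit _ fun i hi => (hgi i hi).abs]
    _ < ε := by
        rw [div_mul_eq_mul_div, div_lt_iff₀ (by positivity)]
        nlinarith

/-- Riemann–Stieltjes sums `∑ ρ(tᵢ) (b(tᵢ₊₁) - b(tᵢ))` of a `C¹` integrand converge to the
integral defined by integration by parts. -/
theorem tendsto_sum_mul_increment {ρ ρ' b : ℝ → ℝ} {T : ℝ} (hT : 0 ≤ T)
    (hρ : ∀ s, HasDerivAt ρ (ρ' s) s) (hρ' : Continuous ρ') (hb : Continuous b) (hb0 : b 0 = 0) :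
    Tendsto (fun N => ∑ i ∈ Finset.range N,
        ρ (gridPt T N i) * (b (gridPt T N (i + 1)) - b (gridPt T N i))) atTop
      (𝓝 (ρ T * b T - ∫ s in (0 : ℝ)..T, b s * ρ' s)) := by
  -- Summation by parts pairs `b(tᵢ₊₁)` with the increment of `ρ` on the cell, hence the right
  -- endpoint as tag.
  have hlim := tendsto_sum_mul_integral hT hb (hρ'.intervalIntegrable 0 T)
    (τ := fun N i => gridPt T N (i + 1))
    (fun N i => ⟨monotone_gridPt hT N i.le_succ, le_rfl⟩)
  refine (hlim.const_sub (ρ T * b T)).congr' ?_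
  filter_upwards [eventually_ne_atTop 0] with N hN
  have htel := Finset.sum_range_sub (fun i => ρ (gridPt T N i) * b (gridPt T N i)) N
  rw [gridPt_self T hN, gridPt_zero, hb0, mul_zero, sub_zero] at htel
  rw [← htel, ← Finset.sum_sub_distrib]
  refine Finset.sum_congr rfl fun i _ => ?_
  rw [intervalIntegral.integral_eq_sub_of_hasDerivAt (fun s _ => hρ s)
    (hρ'.intervalIntegrable _ _)]
  ring

variable {Ω : Type*} [MeasurableSpace Ω] {P : Measure Ω}

theorem hasLaw_sum_gaussianReal [IsProbabilityMeasure P] {ι : Type*} {Y : ι → Ω → ℝ} {v : ι → ℝ≥0}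
    (hind : iIndepFun Y P) (hY : ∀ i, HasLaw (Y i) (gaussianReal 0 (v i)) P) (s : Finset ι) :
    HasLaw (fun ω => ∑ i ∈ s, Y i ω) (gaussianReal 0 (∑ i ∈ s, v i)) P := by
  classical
  induction s using Finset.induction_on with
  | empty =>
    simp only [Finset.sum_empty, gaussianReal_zero_var]
    exact ⟨by fun_prop, by simp [Measure.map_const]⟩
  | insert i s hi ih =>
    have h := hind.indepFun_finsetSum_of_notMem₀ (fun i => (hY i).aemeasurable) hi
    have hs : (∑ j ∈ s, Y j) = fun ω => ∑ j ∈ s, Y j ω := by ext; simp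
    rw [hs] at h
    have h2 := gaussianReal_add_gaussianReal_of_indepFun h.symm (hY i).map_eq ih.map_eq
    rw [zero_add] at h2
    refine ⟨?_, ?_⟩
    · simp_rw [Finset.sum_insert hi]
      exact (hY i).aemeasurable.add ih.aemeasurable
    · simp_rw [Finset.sum_insert hi]
      exact h2

/-- An almost sure limit of centered Gaussian variables is Gaussian. -/
theorem hasLaw_gaussianReal_of_tendsto [IsProbabilityMeasure P] {Y : ℕ → Ω → ℝ} {Z : Ω → ℝ}
    {v : ℕ → ℝ≥0} {v' : ℝ≥0} (hY : ∀ N, HasLaw (Y N) (gaussianReal 0 (v N)) P)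
    (hlim : ∀ᵐ ω ∂P, Tendsto (fun N => Y N ω) atTop (𝓝 (Z ω)))
    (hv : Tendsto v atTop (𝓝 v')) : HasLaw Z (gaussianReal 0 v') P := by
  have hZ : AEMeasurable Z P :=
    aemeasurable_of_tendsto_metrizable_ae _ (fun N => (hY N).aemeasurable) hlim
  refine ⟨hZ, ?_⟩
  have := Measure.isProbabilityMeasure_map hZ
  -- Characteristic functions converge by dominated convergence, their integrands having modulus
  -- one, and the Gaussian ones depend continuously on the variance.
  refine Measure.ext_of_charFun (funext fun t => ?_)
  have h1 : Tendsto (fun N => charFun (P.map (Y N)) t) atTop (𝓝 (charFun (P.map Z) t)) := by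
    have hcf : ∀ {X : Ω → ℝ}, AEMeasurable X P →
        charFun (P.map X) t = ∫ ω, Complex.exp (t * X ω * Complex.I) ∂P := by
      intro X hX
      rw [charFun_apply_real, integral_map hX]
      exact Continuous.aestronglyMeasurable (by fun_prop)
    simp_rw [hcf hZ, fun N => hcf (hY N).aemeasurable]
    refine tendsto_integral_of_dominated_convergence (fun _ => 1) (fun N => ?_)
      (integrable_const _) (fun N => ae_of_all _ fun ω => ?_) ?_
    · have := (hY N).aemeasurable
      have hc : Measurable fun x : ℝ => Complex.exp (t * x * Complex.I) := by fun_prop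
      exact (hc.comp_aemeasurable this).aestronglyMeasurable
    · rw [← Complex.ofReal_mul, Complex.norm_exp_ofReal_mul_I]
    · filter_upwards [hlim] with ω hω
      have hc : Continuous fun x : ℝ => Complex.exp (t * x * Complex.I) := by fun_prop
      exact (hc.tendsto _).comp hω
  simp_rw [fun N => (hY N).map_eq, charFun_gaussianReal] at h1
  have hc : Continuous fun x : ℝ≥0 => Complex.exp (t * (0 : ℝ) * Complex.I - x * t ^ 2 / 2) := by
    fun_prop
  rw [charFun_gaussianReal]
  exact tendsto_nhds_unique h1 ((hc.tendsto _).comp hv)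

/-- The Wiener integral of a `C¹` deterministic integrand against Brownian motion on `[0, T]`,
defined pathwise by integration by parts. -/
noncomputable def wienerIntegral (ρ ρ' : ℝ → ℝ) (T : ℝ) (b : ℝ≥0 → ℝ) : ℝ :=
  ρ T * b T.toNNReal - ∫ s in (0 : ℝ)..T, b s.toNNReal * ρ' s

theorem tendsto_sum_wienerIntegral {ρ ρ' : ℝ → ℝ} {T : ℝ} (hT : 0 ≤ T)
    (hρ : ∀ s, HasDerivAt ρ (ρ' s) s) (hρ' : Continuous ρ') {b : ℝ≥0 → ℝ} (hb : Continuous b)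
    (hb0 : b 0 = 0) :
    Tendsto (fun N => ∑ i ∈ Finset.range N, ρ (gridPt T N i) *
      (b (gridPt T N (i + 1)).toNNReal - b (gridPt T N i).toNNReal)) atTop
      (𝓝 (wienerIntegral ρ ρ' T b)) :=
  tendsto_sum_mul_increment hT hρ hρ' (b := fun s => b s.toNNReal)
    (hb.comp continuous_real_toNNReal) (by simpa using hb0)

/-- Increments over successive cells are independent with variance `T / N`, and the weights are
deterministic. -/
theorem hasLaw_sum_mul_increment [IsProbabilityMeasure P] {b : ℝ≥0 → Ω → ℝ}
    (hb : IsPreBrownianReal b P) (ρ : ℝ → ℝ) {T : ℝ} (hT : 0 ≤ T) (N : ℕ) :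
    HasLaw (fun ω => ∑ i ∈ Finset.range N, ρ (gridPt T N i) *
      (b (gridPt T N (i + 1)).toNNReal ω - b (gridPt T N i).toNNReal ω))
      (gaussianReal 0 (∑ i ∈ Finset.range N,
        NNReal.mk (ρ (gridPt T N i) ^ 2) (sq_nonneg _) * (T / N).toNNReal)) P := by
  have hmono : Monotone fun i => (gridPt T N i).toNNReal := fun i j hij =>
    Real.toNNReal_mono (monotone_gridPt hT N hij)
  have hind := (hb.hasIndepIncrements.nat hmono).comp
    (fun i x => ρ (gridPt T N i) * x) (fun i => by fun_prop)
  refine hasLaw_sum_gaussianReal hind (fun i => ?_) (Finset.range N)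
  have h := gaussianReal_const_mul (hb.hasLaw_sub (gridPt T N (i + 1)).toNNReal
    (gridPt T N i).toNNReal) (ρ (gridPt T N i))
  rw [mul_zero] at h
  have hd : nndist ((gridPt T N (i + 1)).toNNReal : ℝ) ((gridPt T N i).toNNReal : ℝ) =
      (T / N).toNNReal := by
    rw [← NNReal.coe_inj, coe_nndist, Real.dist_eq, Real.coe_toNNReal (gridPt T N i) (gridPt_nonneg hT N _),
      Real.coe_toNNReal _ (gridPt_nonneg hT N _), Real.coe_toNNReal _ (div_nonneg hT N.cast_nonneg),
      gridPt_succ_sub, abs_of_nonneg (by positivity)]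
  have hd' := congrArg (NNReal.mk (ρ (gridPt T N i) ^ 2) (sq_nonneg _) * ·) hd
  exact hd' ▸ h

/-- A sum of Wiener integrals against independent Brownian motions is a centered Gaussian variable
whose variance is the sum of the squared `L²` norms of the integrands. -/
theorem hasLaw_sum_wienerIntegral [IsProbabilityMeasure P] {n : ℕ} {W : Fin n → ℝ≥0 → Ω → ℝ}
    (hW : IsBrownianVec W P) {ρ ρ' : Fin n → ℝ → ℝ} {T : ℝ} (hT : 0 ≤ T)
    (hρ : ∀ j s, HasDerivAt (ρ j) (ρ' j s) s) (hρ' : ∀ j, Continuous (ρ' j)) :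
    HasLaw (fun ω => ∑ j, wienerIntegral (ρ j) (ρ' j) T (fun t => W j t ω))
      (gaussianReal 0 (∑ j, ∫ s in (0 : ℝ)..T, ρ j s ^ 2).toNNReal) P := by
  -- Each Riemann sum is a measurable functional of one whole path, so independence of the
  -- coordinate processes passes to the sums.
  set φ : ℕ → Fin n → (ℝ≥0 → ℝ) → ℝ := fun N j b => ∑ i ∈ Finset.range N, ρ j (gridPt T N i) *
      (b (gridPt T N (i + 1)).toNNReal - b (gridPt T N i).toNNReal) with hφ
  refine hasLaw_gaussianReal_of_tendsto (Y := fun N ω => ∑ j, φ N j (fun t => W j t ω))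
    (v := fun N => ∑ j, ∑ i ∈ Finset.range N,
        NNReal.mk (ρ j (gridPt T N i) ^ 2) (sq_nonneg _) * (T / N).toNNReal) (fun N => ?_) ?_ ?_
  · have hind := hW.indep.comp (φ N) (fun j => by simp only [hφ]; fun_prop)
    exact hasLaw_sum_gaussianReal hind
      (fun j => hasLaw_sum_mul_increment (hW.isBrownian j).toIsPreBrownianReal (ρ j) hT N)
      Finset.univ
  · have hc : ∀ᵐ ω ∂P, ∀ j, Continuous (W j · ω) := ae_all_iff.2 fun j => (hW.isBrownian j).cont
    have h0 : ∀ᵐ ω ∂P, ∀ j, W j 0 ω = 0 :=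
      ae_all_iff.2 fun j => (hW.isBrownian j).eval_zero_ae_eq_zero
    filter_upwards [hc, h0] with ω hcω h0ω
    exact tendsto_finsetSum _ fun j _ =>
      tendsto_sum_wienerIntegral hT (hρ j) (hρ' j) (hcω j) (h0ω j)
  -- The variances are themselves Riemann sums of `ρ j ^ 2` against the density `1`.
  · refine tendsto_real_toNNReal (m := fun N => ∑ j, ∑ i ∈ Finset.range N,
        ρ j (gridPt T N i) ^ 2 * ∫ s in gridPt T N i..gridPt T N (i + 1), (1 : ℝ)) ?_ |>.congr ?_
    · refine tendsto_finsetSum _ fun j _ => ?_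
      have hcont : Continuous (ρ j) :=
        continuous_iff_continuousAt.2 fun s => (hρ j s).continuousAt
      have := tendsto_sum_mul_integral (f := fun s => ρ j s ^ 2) (g := fun _ => 1) hT
        (by fun_prop) (by simp) (τ := fun N i => gridPt T N i)
        (fun N i => ⟨le_rfl, monotone_gridPt hT N i.le_succ⟩)
      simpa using this
    · intro N
      rw [← NNReal.coe_inj, Real.coe_toNNReal]
      · push_cast
        simp only [intervalIntegral.integral_const, gridPt_succ_sub, smul_eq_mul, mul_one]
        rw [Real.coe_toNNReal _ (div_nonneg hT N.cast_nonneg)]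
      · simp only [intervalIntegral.integral_const, gridPt_succ_sub, smul_eq_mul, mul_one]
        positivity

end QuantileEnergy

namespace QuantileEnergy

open Filter Topology

/-! ### Vector integration by parts and variation of constants -/

theorem intervalIntegrable_pi_iff {n : ℕ} {g : ℝ → Fin n → ℝ} {a b : ℝ} :
    IntervalIntegrable g volume a b ↔ ∀ i, IntervalIntegrable (fun s => g s i) volume a b := by
  simp only [intervalIntegrable_iff, IntegrableOn]
  exact integrable_pi_iff

theorem intervalIntegral_apply {n : ℕ} {g : ℝ → Fin n → ℝ} {a b : ℝ}
    (hg : IntervalIntegrable g volume a b) (i : Fin n) :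
    (∫ s in a..b, g s) i = ∫ s in a..b, g s i :=
  ((ContinuousLinearMap.proj (R := ℝ) (φ := fun _ : Fin n => ℝ) i).intervalIntegral_comp_comm
    hg).symm

theorem intervalIntegral_dotProduct {n : ℕ} {g : ℝ → Fin n → ℝ} {a b : ℝ}
    (hg : IntervalIntegrable g volume a b) (w : Fin n → ℝ) :
    w ⬝ᵥ (∫ s in a..b, g s) = ∫ s in a..b, w ⬝ᵥ g s := by
  simp only [dotProduct, intervalIntegral_apply hg]
  rw [intervalIntegral.integral_finsetSum fun i _ =>
    (intervalIntegrable_pi_iff.1 hg i).const_mul _]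
  simp only [intervalIntegral.integral_const_mul]

theorem intervalIntegrable_mulVec {k n : ℕ} {Φ : ℝ → Matrix (Fin k) (Fin n) ℝ}
    {g : ℝ → Fin n → ℝ} {a b : ℝ} (hΦ : ∀ i j, ContinuousOn (fun s => Φ s i j) (uIcc a b))
    (hg : IntervalIntegrable g volume a b) :
    IntervalIntegrable (fun s => Φ s *ᵥ g s) volume a b := by
  refine intervalIntegrable_pi_iff.2 fun i => ?_
  have : (fun s => (Φ s *ᵥ g s) i) = ∑ j, fun s => Φ s i j * g s j := by
    ext s; simp [mulVec, dotProduct]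
  rw [this]
  exact IntervalIntegrable.sum _ fun j _ =>
    (intervalIntegrable_pi_iff.1 hg j).continuousOn_mul (hΦ i j)

/-- Integration by parts of a `C¹` function against the primitive of an integrable function. -/
theorem mul_primitive_sub_eq_integral {f f' g : ℝ → ℝ} (hf : ∀ s, HasDerivAt f (f' s) s)
    (hf' : Continuous f') (y : ℝ) {t : ℝ} (hg : IntervalIntegrable g volume 0 t) :
    f t * (y + ∫ s in (0 : ℝ)..t, g s) - f 0 * y =
      ∫ s in (0 : ℝ)..t, (f s * g s + f' s * (y + ∫ r in (0 : ℝ)..s, g r)) := by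
  have hderiv : deriv f = f' := funext fun s => (hf s).deriv
  have hfc : ContDiff ℝ 1 f := by
    rw [contDiff_one_iff_deriv]
    exact ⟨fun s => (hf s).differentiableAt, hderiv ▸ hf'⟩
  -- Since `g` is merely integrable, its primitive is differentiable only almost everywhere;
  -- absolute continuity is what justifies integration by parts.
  have hfa : AbsolutelyContinuousOnInterval f 0 t := hfc.contDiffOn.absolutelyContinuousOnInterval
  have hga : AbsolutelyContinuousOnInterval (fun s => y + ∫ r in (0 : ℝ)..s, g r) 0 t :=
    (contDiff_const.contDiffOn.absolutelyContinuousOnInterval).add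
      (hg.absolutelyContinuousOnInterval_intervalIntegral (by simp))
  have key := hfa.integral_deriv_mul_eq_sub hga
  simp only [intervalIntegral.integral_same, add_zero] at key
  rw [← key]
  refine intervalIntegral.integral_congr_ae ?_
  filter_upwards [hg.ae_hasDerivAt_integral] with s hs hst
  rw [((hs (uIoc_subset_uIcc hst) 0 (by simp)).const_add y).deriv, hderiv]
  ring

theorem mulVec_primitive_sub_eq_integral {k n : ℕ} {Φ Φ' : ℝ → Matrix (Fin k) (Fin n) ℝ}
    (hΦ : ∀ i j s, HasDerivAt (fun r => Φ r i j) (Φ' s i j) s)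
    (hΦ' : ∀ i j, Continuous fun s => Φ' s i j) (y : Fin n → ℝ) {g : ℝ → Fin n → ℝ} {t : ℝ}
    (hg : IntervalIntegrable g volume 0 t) :
    Φ t *ᵥ (y + ∫ s in (0 : ℝ)..t, g s) - Φ 0 *ᵥ y =
      ∫ s in (0 : ℝ)..t, (Φ s *ᵥ g s + Φ' s *ᵥ (y + ∫ r in (0 : ℝ)..s, g r)) := by
  have hΦc : ∀ i j, Continuous fun s => Φ s i j := fun i j =>
    continuous_iff_continuousAt.2 fun s => (hΦ i j s).continuousAt
  have hgi := intervalIntegrable_pi_iff.1 hg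
  have hprim : ContinuousOn (fun s => y + ∫ r in (0 : ℝ)..s, g r) (uIcc 0 t) :=
    continuousOn_const.add (intervalIntegral.continuousOn_primitive_interval' hg (by simp))
  have hint := (intervalIntegrable_mulVec (fun i j => (hΦc i j).continuousOn) hg).add
    (intervalIntegrable_mulVec (fun i j => (hΦ' i j).continuousOn) hprim.intervalIntegrable)
  have hsub : ∀ s ∈ uIcc 0 t, ∀ j, (∫ r in (0 : ℝ)..s, g r) j = ∫ r in (0 : ℝ)..s, g r j :=
    fun s hs j => intervalIntegral_apply
      (hg.mono_set (uIcc_subset_uIcc left_mem_uIcc hs)) j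
  ext i
  rw [intervalIntegral_apply hint]
  simp only [Pi.sub_apply, Pi.add_apply, mulVec, dotProduct]
  rw [← Finset.sum_sub_distrib]
  have hij : ∀ j, IntervalIntegrable (fun s => Φ s i j * g s j +
      Φ' s i j * (y j + ∫ r in (0 : ℝ)..s, g r j)) volume 0 t := by
    intro j
    refine ((hgi j).continuousOn_mul (hΦc i j).continuousOn).add (ContinuousOn.intervalIntegrable ?_)
    exact (hΦ' i j).continuousOn.mul (continuousOn_const.add
      (intervalIntegral.continuousOn_primitive_interval' (hgi j) (by simp)))
  calc _ = ∑ j, ∫ s in (0 : ℝ)..t, (Φ s i j * g s j +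
      Φ' s i j * (y j + ∫ r in (0 : ℝ)..s, g r j)) := by
        refine Finset.sum_congr rfl fun j _ => ?_
        rw [hsub t (by simp), mul_primitive_sub_eq_integral (hΦ i j) (hΦ' i j) (y j) (hgi j)]
    _ = _ := by
        rw [← intervalIntegral.integral_finsetSum fun j _ => hij j]
        refine intervalIntegral.integral_congr fun s hs => ?_
        simp only [hsub s hs, Finset.sum_add_distrib]

section Transition

variable {n : ℕ} (A : Matrix (Fin n) (Fin n) ℝ)

theorem transition_self (t : ℝ) : transition A t t = 1 := by
  simp [transition]

theorem transition_mul_transition (t s r : ℝ) :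
    transition A t s * transition A s r = transition A t r := by
  rw [transition, transition, transition, ← Matrix.exp_add_of_commute, ← add_smul]
  · congr 2; ring
  · exact ((Commute.refl A).smul_left _).smul_right _

theorem hasDerivAt_transition_left (t r : ℝ) (i j : Fin n) :
    HasDerivAt (fun s => transition A s r i j) ((A * transition A t r) i j) t := by
  -- A matrix norm is chosen locally to differentiate the exponential; the entrywise conclusion is
  -- free of that choice.
  let _ : NormedRing (Matrix (Fin n) (Fin n) ℝ) := Matrix.linftyOpNormedRing
  let _ : NormedAlgebra ℝ (Matrix (Fin n) (Fin n) ℝ) := Matrix.linftyOpNormedAlgebra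
  have h : HasDerivAt (fun s : ℝ => transition A s r) (A * transition A t r) t := by
    have h1 := (hasDerivAt_exp_smul_const' (𝕂 := ℝ) A (t - r)).scomp t ((hasDerivAt_id t).sub_const r)
    simp only [Function.comp_def, one_smul, id] at h1
    exact h1
  exact (hasDerivAt_pi.1 ((hasDerivAt_pi.1 h) i)) j

theorem hasDerivAt_transition_right (t r : ℝ) (i j : Fin n) :
    HasDerivAt (fun s => transition A r s i j) ((-(transition A r t * A)) i j) t := by
  let _ : NormedRing (Matrix (Fin n) (Fin n) ℝ) := Matrix.linftyOpNormedRing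
  let _ : NormedAlgebra ℝ (Matrix (Fin n) (Fin n) ℝ) := Matrix.linftyOpNormedAlgebra
  have h : HasDerivAt (fun s : ℝ => transition A r s) (-(transition A r t * A)) t := by
    have h1 := (hasDerivAt_exp_smul_const (𝕂 := ℝ) A (r - t)).scomp t ((hasDerivAt_id t).const_sub r)
    simp only [Function.comp_def, one_smul, neg_smul] at h1
    exact h1
  exact (hasDerivAt_pi.1 ((hasDerivAt_pi.1 h) i)) j

theorem continuous_transition_left (r : ℝ) : Continuous fun s => transition A s r :=
  continuous_matrix fun i j => continuous_iff_continuousAt.2 fun s =>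
    (hasDerivAt_transition_left A s r i j).continuousAt

theorem continuous_transition_right (r : ℝ) : Continuous fun s => transition A r s :=
  continuous_matrix fun i j => continuous_iff_continuousAt.2 fun s =>
    (hasDerivAt_transition_right A s r i j).continuousAt

variable {A}

/-- Variation of constants: the terminal value of a solution of
`x t = x₀ + ∫₀ᵗ (A x + b) + N t`. -/
theorem terminal_eq_of_integral_eq {x N b : ℝ → Fin n → ℝ} {x₀ : Fin n → ℝ} {T : ℝ} (hT : 0 ≤ T)
    (hx : ContinuousOn x (Icc 0 T)) (hN : ContinuousOn N (Icc 0 T))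
    (hb : IntervalIntegrable b volume 0 T)
    (heq : ∀ t ∈ Icc 0 T, x t = x₀ + (∫ s in (0 : ℝ)..t, (A *ᵥ x s + b s)) + N t) :
    x T = transition A T 0 *ᵥ x₀ + (∫ s in (0 : ℝ)..T, transition A T s *ᵥ b s) +
      (N T + ∫ s in (0 : ℝ)..T, transition A T s *ᵥ (A *ᵥ N s)) := by
  rw [← uIcc_of_le hT] at hx hN heq
  have hAx : IntervalIntegrable (fun s => A *ᵥ x s) volume 0 T :=
    intervalIntegrable_mulVec (Φ := fun _ => A) (fun _ _ => continuousOn_const)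
      hx.intervalIntegrable
  have hAN : IntervalIntegrable (fun s => A *ᵥ N s) volume 0 T :=
    intervalIntegrable_mulVec (Φ := fun _ => A) (fun _ _ => continuousOn_const)
      hN.intervalIntegrable
  have hΨ : ∀ i j, ContinuousOn (fun s => transition A T s i j) (uIcc 0 T) := fun i j =>
    ((continuous_transition_right A T).matrix_elem i j).continuousOn
  -- The product rule is applied to `Ψ(T,s)` times `x - N`, which is absolutely continuous even when
  -- `N` is rough. The derivative `-Ψ A` cancels the `A x` term and leaves `Ψ (A N + b)`.
  have key := mulVec_primitive_sub_eq_integral (Φ := fun s => transition A T s)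
    (Φ' := fun s => -(transition A T s * A))
    (fun i j s => hasDerivAt_transition_right A s T i j)
    (fun i j => (((continuous_transition_right A T).matrix_mul continuous_const).neg).matrix_elem
      i j) x₀ (hAx.add hb)
  have hcongr : ∀ s ∈ uIcc 0 T, transition A T s *ᵥ (A *ᵥ x s + b s) +
      -(transition A T s * A) *ᵥ (x₀ + ∫ r in (0 : ℝ)..s, (A *ᵥ x r + b r)) =
      transition A T s *ᵥ b s + transition A T s *ᵥ (A *ᵥ N s) := by
    intro s hs
    have : x₀ + ∫ r in (0 : ℝ)..s, (A *ᵥ x r + b r) = x s - N s := by rw [heq s hs]; abel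
    rw [this, neg_mulVec, ← mulVec_mulVec, mulVec_sub, mulVec_add, mulVec_sub]
    abel
  rw [intervalIntegral.integral_congr hcongr,
    intervalIntegral.integral_add (intervalIntegrable_mulVec hΨ hb)
      (intervalIntegrable_mulVec hΨ hAN), transition_self, one_mulVec] at key
  rw [heq T right_mem_uIcc, sub_eq_iff_eq_add.1 key]
  abel

/-- The solution of `x t = x₀ + ∫₀ᵗ (A x + b) + N t` given by variation of constants. -/
noncomputable def variationOfConstants (A : Matrix (Fin n) (Fin n) ℝ) (x₀ : Fin n → ℝ)
    (b N : ℝ → Fin n → ℝ) (t : ℝ) : Fin n → ℝ :=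
  transition A t 0 *ᵥ (x₀ + ∫ s in (0 : ℝ)..t, transition A 0 s *ᵥ (A *ᵥ N s + b s)) + N t

section VariationOfConstants

variable {N b : ℝ → Fin n → ℝ} {T : ℝ}

theorem intervalIntegrable_transition_mulVec (hN : ContinuousOn N (uIcc 0 T))
    (hb : IntervalIntegrable b volume 0 T) :
    IntervalIntegrable (fun s => transition A 0 s *ᵥ (A *ᵥ N s + b s)) volume 0 T :=
  intervalIntegrable_mulVec
    (fun i j => ((continuous_transition_right A 0).matrix_elem i j).continuousOn)
    ((intervalIntegrable_mulVec (Φ := fun _ => A) (fun _ _ => continuousOn_const)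
      hN.intervalIntegrable).add hb)

theorem continuousOn_variationOfConstants (x₀ : Fin n → ℝ) (hN : ContinuousOn N (uIcc 0 T))
    (hb : IntervalIntegrable b volume 0 T) :
    ContinuousOn (variationOfConstants A x₀ b N) (uIcc 0 T) := by
  have h := intervalIntegral.continuousOn_primitive_interval'
    (intervalIntegrable_transition_mulVec (A := A) hN hb) left_mem_uIcc
  have hΨ := continuous_transition_left A 0
  rw [continuousOn_iff_continuous_domRestrict] at h hN ⊢
  exact ((hΨ.comp continuous_subtype_val).matrix_mulVec (continuous_const.add h)).add hN

/-- Subtracting `N` leaves the linear equation `y' = A y + (A N + b)` with integrable forcing, to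
which the product rule for `Ψ(t,0)` times a primitive applies. -/
theorem variationOfConstants_eq (x₀ : Fin n → ℝ) (hN : ContinuousOn N (uIcc 0 T))
    (hb : IntervalIntegrable b volume 0 T) {t : ℝ} (ht : t ∈ uIcc 0 T) :
    variationOfConstants A x₀ b N t =
      x₀ + (∫ s in (0 : ℝ)..t, (A *ᵥ variationOfConstants A x₀ b N s + b s)) + N t := by
  have hsub := uIcc_subset_uIcc (left_mem_uIcc (a := (0 : ℝ)) (b := T)) ht
  have key := mulVec_primitive_sub_eq_integral (Φ := fun s => transition A s 0)
    (Φ' := fun s => A * transition A s 0)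
    (fun i j s => hasDerivAt_transition_left A s 0 i j)
    (fun i j => (continuous_const.matrix_mul (continuous_transition_left A 0)).matrix_elem i j) x₀
    ((intervalIntegrable_transition_mulVec (A := A) hN hb).mono_set hsub)
  rw [transition_self, one_mulVec, sub_eq_iff_eq_add] at key
  rw [variationOfConstants, key, add_comm x₀]
  congr 2
  refine intervalIntegral.integral_congr fun s _ => ?_
  simp only [variationOfConstants, mulVec_mulVec, ← Matrix.mul_assoc, transition_mul_transition,
    transition_self, Matrix.one_mul, one_mulVec, mulVec_add]
  abel

end VariationOfConstants

end Transition

end QuantileEnergy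

namespace QuantileEnergy

open Filter Topology

/-! ### The standard normal distribution function and its quantile -/

section StdNormal

local notation "Φ" => cdf (gaussianReal 0 1)

/-- Lebesgue measure is absolutely continuous with respect to the Gaussian, so no nonempty interval
`(x, y]` is Gaussian-null. -/
theorem strictMono_cdf_stdNormal : StrictMono Φ := by
  intro x y hxy
  refine lt_of_le_of_ne (monotone_cdf _ hxy.le) fun heq => ?_
  have h : (cdf (gaussianReal 0 1)).measure (Ioc x y) = 0 := by
    rw [StieltjesFunction.measure_Ioc, heq, sub_self, ENNReal.ofReal_zero]
  rw [measure_cdf] at h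
  have := gaussianReal_absolutelyContinuous' 0 one_ne_zero h
  rw [Real.volume_Ioc, ENNReal.ofReal_eq_zero] at this
  linarith

theorem continuous_cdf_stdNormal : Continuous Φ := by
  refine continuous_iff_continuousAt.2 fun x => ?_
  rw [(monotone_cdf _).continuousAt_iff_leftLim_eq_rightLim, StieltjesFunction.rightLim_eq]
  have := nullSingletonClass_gaussianReal (μ := 0) (v := 1) one_ne_zero
  have h : (cdf (gaussianReal 0 1)).measure {x} = 0 := by rw [measure_cdf, measure_singleton]
  rw [StieltjesFunction.measure_singleton, ENNReal.ofReal_eq_zero] at h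
  exact le_antisymm ((monotone_cdf _).leftLim_le le_rfl) (by linarith)

theorem cdf_stdNormal_mem_Ioo (x : ℝ) : Φ x ∈ Ioo (0 : ℝ) 1 :=
  ⟨(cdf_nonneg _ (x - 1)).trans_lt (strictMono_cdf_stdNormal (by linarith)),
    (strictMono_cdf_stdNormal (by linarith : x < x + 1)).trans_le (cdf_le_one _ _)⟩

theorem stdNormalQuantile_cdf (x : ℝ) : stdNormalQuantile (Φ x) = x := by
  have : {y : ℝ | Φ x ≤ Φ y} = Ici x := by
    ext y
    simp [strictMono_cdf_stdNormal.le_iff_le]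
  rw [stdNormalQuantile, this, csInf_Ici]

theorem cdf_stdNormalQuantile {p : ℝ} (hp : p ∈ Ioo (0 : ℝ) 1) : Φ (stdNormalQuantile p) = p := by
  obtain ⟨x, hx⟩ := mem_range_of_exists_le_of_exists_ge continuous_cdf_stdNormal
    ((tendsto_cdf_atBot (gaussianReal 0 1)).eventually_le_const hp.1).exists
    ((tendsto_cdf_atTop (gaussianReal 0 1)).eventually_const_le hp.2).exists
  rw [← hx, stdNormalQuantile_cdf]

theorem cdf_stdNormal_eq_iff {x p : ℝ} (hp : p ∈ Ioo (0 : ℝ) 1) :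
    Φ x = p ↔ x = stdNormalQuantile p :=
  ⟨fun h => by rw [← h, stdNormalQuantile_cdf], fun h => by rw [h, cdf_stdNormalQuantile hp]⟩

theorem measureReal_le_add_gaussian {Ω : Type*} [MeasurableSpace Ω] {P : Measure Ω} {Z : Ω → ℝ}
    {v : ℝ} (hv : 0 < v) (hZ : HasLaw Z (gaussianReal 0 v.toNNReal) P) (a c : ℝ) :
    P.real {ω | a ≤ c + Z ω} = Φ ((c - a) / √v) := by
  have hs : 0 < √v := Real.sqrt_pos.2 hv
  -- The negative factor standardizes `Z` and also turns the upper tail event into a lower one, as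
  -- the distribution function requires.
  have h := gaussianReal_mul_const hZ (-(√v)⁻¹)
  have hvar : NNReal.mk ((-(√v)⁻¹) ^ 2) (sq_nonneg _) * v.toNNReal = 1 := by
    rw [← NNReal.coe_inj]
    push_cast [Real.coe_toNNReal _ hv.le]
    rw [neg_sq, inv_pow, Real.sq_sqrt hv.le, inv_mul_cancel₀ hv.ne']
  rw [hvar, mul_zero] at h
  rw [cdf_eq_real, ← h.map_eq, measureReal_def, measureReal_def,
    Measure.map_apply_of_aemeasurable h.aemeasurable measurableSet_Iic]
  congr 2
  ext ω
  simp only [mem_ofPred_eq, mem_preimage, mem_Iic, mul_neg, ← div_eq_mul_inv]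
  rw [← neg_div, div_le_div_iff_of_pos_right hs]
  constructor <;> intro h <;> linarith

end StdNormal

/-! ### Algebra of `Σ^{1/2}`, the effort weight and its pseudoinverse -/

section Algebra

variable {n m : ℕ} {Sig : Matrix (Fin n) (Fin n) ℝ}

theorem transpose_eq_of_posDef (hSig : Sig.PosDef) : Sigᵀ = Sig := by
  simpa [IsHermitian, conjTranspose_eq_transpose_of_trivial] using hSig.isHermitian

open scoped MatrixOrder in
theorem sqrt_mul_sqrt_of_posDef (hSig : Sig.PosDef) : CFC.sqrt Sig * CFC.sqrt Sig = Sig :=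
  CFC.sqrt_mul_sqrt_self Sig hSig.posSemidef.nonneg

open scoped MatrixOrder in
theorem transpose_sqrt : (CFC.sqrt Sig)ᵀ = CFC.sqrt Sig := by
  have h := (Matrix.nonneg_iff_posSemidef.1 (CFC.sqrt_nonneg Sig)).isHermitian
  simpa [IsHermitian, conjTranspose_eq_transpose_of_trivial] using h

variable (B : Matrix (Fin n) (Fin m) ℝ)

theorem effortWeight_transpose (hSig : Sig.PosDef) :
    (effortWeight B Sig)ᵀ = effortWeight B Sig := by
  simp only [effortWeight, transpose_mul, transpose_transpose, transpose_nonsing_inv,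
    transpose_eq_of_posDef hSig, Matrix.mul_assoc]

theorem pinv_effortWeight_transpose (hSig : Sig.PosDef) :
    (pinv (effortWeight B Sig))ᵀ = pinv (effortWeight B Sig) := by
  have h := (pinv_spec (effortWeight B Sig)).transpose
  rw [effortWeight_transpose B hSig] at h
  exact h.unique (pinv_spec _)

theorem dotProduct_effortWeight_nonneg (hSig : Sig.PosDef) (x : Fin m → ℝ) :
    0 ≤ x ⬝ᵥ (effortWeight B Sig *ᵥ x) := by
  have h := hSig.inv.posSemidef.dotProduct_mulVec_nonneg (B *ᵥ x)
  simpa [effortWeight, ← mulVec_mulVec, dotProduct_mulVec, vecMul_transpose] using h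

/-- The range of `Bᵀ` is fixed by the projection `M M⁺`. -/
theorem effortWeight_mul_pinv_mul_transpose (hSig : Sig.PosDef) :
    effortWeight B Sig * pinv (effortWeight B Sig) * Bᵀ = Bᵀ := by
  set M := effortWeight B Sig with hM
  set N := pinv M
  have hMt : Mᵀ = M := effortWeight_transpose B hSig
  have hNt : Nᵀ = N := pinv_effortWeight_transpose B hSig
  have hMNM : M * N * M = M := (pinv_spec M).mul_mul_self
  -- `D` measures the failure of `B M⁺ M = B`. Its Gram matrix for `Σ⁻¹` has the factor `M (M⁺ M -
  -- 1) = 0`, and definiteness of `Σ⁻¹` then kills every column; transposing gives the claim.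
  set D := B * (N * M) - B with hD
  have hzero : Dᵀ * Sig⁻¹ * D = 0 := by
    have h1 : Dᵀ * Sig⁻¹ * D = ((N * M)ᵀ - 1) * M * (N * M - 1) := by
      rw [hD, hM]
      simp only [effortWeight, transpose_sub, transpose_mul, Matrix.sub_mul, Matrix.mul_sub,
        Matrix.one_mul, Matrix.mul_one, Matrix.mul_assoc]
    rw [h1, Matrix.mul_assoc, Matrix.mul_sub, Matrix.mul_one, ← Matrix.mul_assoc M N M, hMNM,
      sub_self, Matrix.mul_zero]
  have hD0 : D = 0 := by
    ext i j
    have hcol : D *ᵥ Pi.single j 1 = 0 := by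
      by_contra hne
      have hpos := hSig.inv.dotProduct_mulVec_pos hne
      have : star (D *ᵥ Pi.single j 1) ⬝ᵥ (Sig⁻¹ *ᵥ (D *ᵥ Pi.single j 1)) =
          Pi.single j 1 ⬝ᵥ ((Dᵀ * Sig⁻¹ * D) *ᵥ Pi.single j 1) := by
        simp only [star_trivial, ← mulVec_mulVec, dotProduct_mulVec, vecMul_transpose]
      rw [this, hzero] at hpos
      simp at hpos
    simpa using congrFun hcol i
  have hB : B * (N * M) = B := sub_eq_zero.1 hD0
  have := congrArg Matrix.transpose hB
  rwa [transpose_mul, transpose_mul, hMt, hNt] at this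

theorem dotProduct_sandwich_mulVec {k l : ℕ} (K : Matrix (Fin k) (Fin l) ℝ)
    (Q : Matrix (Fin l) (Fin l) ℝ) (w : Fin k → ℝ) :
    w ⬝ᵥ ((K * Q * Kᵀ) *ᵥ w) = (Kᵀ *ᵥ w) ⬝ᵥ (Q *ᵥ (Kᵀ *ᵥ w)) := by
  simp only [← mulVec_mulVec, dotProduct_mulVec w K, mulVec_transpose]

end Algebra

/-! ### The Gramian and noise covariance as integrated quadratic forms -/

section QuadraticForms

variable {n m : ℕ}

theorem dotProduct_integral_mulVec {F : ℝ → Matrix (Fin n) (Fin n) ℝ} (hF : Continuous F)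
    (T : ℝ) (w : Fin n → ℝ) :
    w ⬝ᵥ ((Matrix.of fun i j => ∫ s in (0 : ℝ)..T, F s i j) *ᵥ w) =
      ∫ s in (0 : ℝ)..T, w ⬝ᵥ (F s *ᵥ w) := by
  have hij : ∀ i j, Continuous fun s => F s i j := fun i j => hF.matrix_elem i j
  simp only [dotProduct, mulVec, of_apply]
  rw [intervalIntegral.integral_finsetSum fun i _ =>
    Continuous.intervalIntegrable (by fun_prop) _ _]
  refine Finset.sum_congr rfl fun i _ => ?_
  rw [intervalIntegral.integral_const_mul, intervalIntegral.integral_finsetSum fun j _ =>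
    Continuous.intervalIntegrable (by fun_prop) _ _]
  simp only [intervalIntegral.integral_mul_const]

variable (A : Matrix (Fin n) (Fin n) ℝ) (B : Matrix (Fin n) (Fin m) ℝ)
  (Sig : Matrix (Fin n) (Fin n) ℝ) (T : ℝ) (w : Fin n → ℝ)

/-- The filter `s ↦ Bᵀ Ψ(T,s)ᵀ w` through which controls act on `wᵀ X_T`. -/
noncomputable def controlFilter (s : ℝ) : Fin m → ℝ := (transition A T s * B)ᵀ *ᵥ w

theorem continuous_controlFilter : Continuous (controlFilter A B T w) :=
  (((continuous_transition_right A T).matrix_mul continuous_const).matrix_transpose).matrix_mulVec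
    continuous_const

theorem dotProduct_gramian_mulVec :
    w ⬝ᵥ (gramian A B Sig T *ᵥ w) = ∫ s in (0 : ℝ)..T,
      controlFilter A B T w s ⬝ᵥ (pinv (effortWeight B Sig) *ᵥ controlFilter A B T w s) := by
  have hΨ := continuous_transition_right A T
  rw [gramian, dotProduct_integral_mulVec (F := fun s =>
    transition A T s * B * pinv (effortWeight B Sig) * Bᵀ * (transition A T s)ᵀ) (by fun_prop)]
  refine intervalIntegral.integral_congr fun s _ => ?_
  simp only [controlFilter]
  rw [← dotProduct_sandwich_mulVec, transpose_mul]
  simp only [Matrix.mul_assoc]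

theorem dotProduct_noiseCov_mulVec :
    w ⬝ᵥ (noiseCov A Sig T *ᵥ w) = ∫ s in (0 : ℝ)..T,
      ((transition A T s)ᵀ *ᵥ w) ⬝ᵥ (Sig *ᵥ ((transition A T s)ᵀ *ᵥ w)) := by
  have hΨ := continuous_transition_right A T
  rw [noiseCov, dotProduct_integral_mulVec (F := fun s =>
    transition A T s * Sig * (transition A T s)ᵀ) (by fun_prop)]
  simp only [dotProduct_sandwich_mulVec]

variable {Sig T w}

/-- Invertibility of `Ψ(T,s)` keeps `Ψ(T,s)ᵀ w` nonzero, so the integrand is positive at every `s`.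
-/
theorem dotProduct_noiseCov_mulVec_pos (hSig : Sig.PosDef) (hT : 0 < T) (hw : w ≠ 0) :
    0 < w ⬝ᵥ (noiseCov A Sig T *ᵥ w) := by
  have hΨ := continuous_transition_right A T
  rw [dotProduct_noiseCov_mulVec]
  refine intervalIntegral.intervalIntegral_pos_of_pos
    (Continuous.intervalIntegrable (by fun_prop) _ _) (fun s => ?_) hT
  have hne : (transition A T s)ᵀ *ᵥ w ≠ 0 := by
    intro h0
    have h1 : (transition A s T)ᵀ *ᵥ ((transition A T s)ᵀ *ᵥ w) = w := by
      rw [mulVec_mulVec, ← transpose_mul, transition_mul_transition, transition_self,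
        transpose_one, one_mulVec]
    rw [h0, mulVec_zero] at h1
    exact hw h1.symm
  simpa using hSig.dotProduct_mulVec_pos hne

end QuadraticForms

end QuantileEnergy

namespace QuantileEnergy

open Filter Topology

/-! ### Solutions of the controlled equation and the law of `wᵀ X_T` -/

section Solutions

variable {n m : ℕ} {A Sig : Matrix (Fin n) (Fin n) ℝ} {B : Matrix (Fin n) (Fin m) ℝ}
  {x₀ w : Fin n → ℝ} {T a : ℝ} {Ω : Type*}
  {W : Fin n → ℝ≥0 → Ω → ℝ} {u : ℝ → Fin m → ℝ}

open scoped MatrixOrder in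
/-- The additive noise path `Σ^{1/2} W` as a function of real time. -/
noncomputable def noisePath (Sig : Matrix (Fin n) (Fin n) ℝ) (W : Fin n → ℝ≥0 → Ω → ℝ) (ω : Ω)
    (t : ℝ) : Fin n → ℝ :=
  CFC.sqrt Sig *ᵥ fun j => W j t.toNNReal ω

theorem continuous_noisePath {ω : Ω} (h : ∀ j, Continuous (W j · ω)) :
    Continuous (noisePath Sig W ω) :=
  continuous_const.matrix_mulVec
    (continuous_pi fun j => (h j).comp continuous_real_toNNReal)

theorem hasDerivAt_vecMul {k l : ℕ} {Φ : ℝ → Matrix (Fin k) (Fin l) ℝ}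
    {Φ' : Matrix (Fin k) (Fin l) ℝ} {s : ℝ}
    (hΦ : ∀ i j, HasDerivAt (fun r => Φ r i j) (Φ' i j) s) (w : Fin k → ℝ) (j : Fin l) :
    HasDerivAt (fun r => (w ᵥ* Φ r) j) ((w ᵥ* Φ') j) s := by
  simp only [vecMul, dotProduct]
  exact HasDerivAt.fun_sum fun i _ => (hΦ i j).const_mul _

theorem hasDerivAt_matrix_mul {k l r : ℕ} {Φ : ℝ → Matrix (Fin k) (Fin l) ℝ}
    {Φ' : Matrix (Fin k) (Fin l) ℝ} {s : ℝ}
    (hΦ : ∀ i j, HasDerivAt (fun r => Φ r i j) (Φ' i j) s) (S : Matrix (Fin l) (Fin r) ℝ)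
    (i : Fin k) (j : Fin r) :
    HasDerivAt (fun r => (Φ r * S) i j) ((Φ' * S) i j) s := by
  simp only [Matrix.mul_apply]
  exact HasDerivAt.fun_sum fun a _ => (hΦ i a).mul_const _

open scoped MatrixOrder in
/-- The weights with which the Brownian increments enter `wᵀ X_T`. -/
noncomputable def noiseFilter (A Sig : Matrix (Fin n) (Fin n) ℝ) (T : ℝ) (w : Fin n → ℝ)
    (j : Fin n) (s : ℝ) : ℝ :=
  (w ᵥ* (transition A T s * CFC.sqrt Sig)) j

open scoped MatrixOrder in
/-- The derivative of `noiseFilter`. -/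
noncomputable def noiseFilterDeriv (A Sig : Matrix (Fin n) (Fin n) ℝ) (T : ℝ) (w : Fin n → ℝ)
    (j : Fin n) (s : ℝ) : ℝ :=
  (w ᵥ* (-(transition A T s * A) * CFC.sqrt Sig)) j

theorem hasDerivAt_noiseFilter (j : Fin n) (s : ℝ) :
    HasDerivAt (noiseFilter A Sig T w j) (noiseFilterDeriv A Sig T w j s) s :=
  hasDerivAt_vecMul (hasDerivAt_matrix_mul (fun i k => hasDerivAt_transition_right A s T i k) _) w j

theorem continuous_noiseFilterDeriv (j : Fin n) :
    Continuous (noiseFilterDeriv A Sig T w j) := by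
  have hΨ := continuous_transition_right A T
  exact (continuous_apply j).comp (continuous_const.matrix_vecMul (by fun_prop))

/-- The weights are the coordinates of `Σ^{1/2} Ψᵀ w`, and `Σ^{1/2}` is symmetric with square `Σ`.
This identifies the variance of the noise with `wᵀ V_T w`. -/
theorem sum_noiseFilter_sq (hSig : Sig.PosDef) (s : ℝ) :
    ∑ j, noiseFilter A Sig T w j s ^ 2 =
      ((transition A T s)ᵀ *ᵥ w) ⬝ᵥ (Sig *ᵥ ((transition A T s)ᵀ *ᵥ w)) := by
  conv_rhs => rw [← sqrt_mul_sqrt_of_posDef hSig]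
  rw [← mulVec_mulVec, dotProduct_mulVec, mulVec_transpose, vecMul_vecMul]
  nth_rewrite 2 [← transpose_sqrt]
  rw [mulVec_transpose, vecMul_vecMul]
  simp only [dotProduct, noiseFilter, sq]

/-- The Gaussian part of `wᵀ X_T`. -/
noncomputable def terminalNoise (A Sig : Matrix (Fin n) (Fin n) ℝ) (T : ℝ) (w : Fin n → ℝ)
    (W : Fin n → ℝ≥0 → Ω → ℝ) (ω : Ω) : ℝ :=
  ∑ j, wienerIntegral (noiseFilter A Sig T w j) (noiseFilterDeriv A Sig T w j) T
    (fun t => W j t ω)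

/-- Because `Ψ(T,T) = 1` and `∂ₛ Ψ(T,s) = -Ψ(T,s) A`, the noise term left by variation of constants
is already in the integrated-by-parts form that defines `wienerIntegral`. -/
theorem terminalNoise_eq {ω : Ω} (hω : ∀ j, Continuous (W j · ω)) :
    w ⬝ᵥ (noisePath Sig W ω T +
      ∫ s in (0 : ℝ)..T, transition A T s *ᵥ (A *ᵥ noisePath Sig W ω s)) =
      terminalNoise A Sig T w W ω := by
  have hΨ := continuous_transition_right A T
  have hN := continuous_noisePath (Sig := Sig) hω
  have hWc : ∀ j, Continuous fun s : ℝ => W j s.toNNReal ω := fun j =>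
    (hω j).comp continuous_real_toNNReal
  have hc := fun j => continuous_noiseFilterDeriv (A := A) (Sig := Sig) (T := T) (w := w) j
  rw [dotProduct_add, intervalIntegral_dotProduct
    ((hΨ.matrix_mulVec (continuous_const.matrix_mulVec hN)).intervalIntegrable _ _)]
  simp only [terminalNoise, wienerIntegral, Finset.sum_sub_distrib]
  rw [← intervalIntegral.integral_finsetSum fun j _ =>
    Continuous.intervalIntegrable (by fun_prop) _ _, sub_eq_add_neg,
    ← intervalIntegral.integral_neg]
  congr 1
  · simp only [noisePath, noiseFilter, transition_self, Matrix.one_mul, dotProduct_mulVec]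
    rfl
  · refine intervalIntegral.integral_congr fun s _ => ?_
    simp only [noisePath, noiseFilterDeriv, mulVec_mulVec, dotProduct_mulVec, Matrix.mul_assoc,
      Matrix.neg_mul, vecMul_neg]
    simp only [dotProduct, Pi.neg_apply, mul_neg, Finset.sum_neg_distrib, neg_neg]
    exact Finset.sum_congr rfl fun _ _ => mul_comm _ _

variable [MeasurableSpace Ω] {P : Measure Ω} {X : ℝ → Ω → Fin n → ℝ}

theorem IsBrownianVec.ae_continuous (hW : IsBrownianVec W P) :
    ∀ᵐ ω ∂P, ∀ j, Continuous (W j · ω) :=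
  ae_all_iff.2 fun j => (hW.isBrownian j).cont

/-- The integral of a Brownian path against a continuous density is measurable. -/
theorem IsBrownianVec.aemeasurable_integral_mul (hW : IsBrownianVec W P) {t : ℝ} (ht : 0 ≤ t)
    {k : ℝ → ℝ} (hk : Continuous k) (j : Fin n) :
    AEMeasurable (fun ω => ∫ s in (0 : ℝ)..t, W j s.toNNReal ω * k s) P := by
  refine aemeasurable_of_tendsto_metrizable_ae atTop
    (f := fun N ω => ∑ i ∈ Finset.range N, W j (gridPt t N i).toNNReal ω *
      ∫ s in gridPt t N i..gridPt t N (i + 1), k s) (fun N => ?_) ?_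
  · exact Finset.aemeasurable_fun_sum _ fun i _ =>
      ((hW.isBrownian j).aemeasurable _).mul_const _
  · filter_upwards [hW.ae_continuous] with ω hω
    exact tendsto_sum_mul_integral ht ((hω j).comp continuous_real_toNNReal)
      (hk.intervalIntegrable _ _) fun N i => ⟨le_rfl, monotone_gridPt ht N i.le_succ⟩

theorem mulVec_integral_eq_sum {k l : ℕ} {K : ℝ → Matrix (Fin k) (Fin l) ℝ} (hK : Continuous K)
    {f : ℝ → Fin l → ℝ} (hf : Continuous f) (t : ℝ) (i : Fin k) :
    (∫ s in (0 : ℝ)..t, K s *ᵥ f s) i = ∑ j, ∫ s in (0 : ℝ)..t, f s j * K s i j := by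
  have hKf : Continuous fun s => K s *ᵥ f s := hK.matrix_mulVec hf
  have hKij : ∀ j, Continuous fun s => K s i j := fun j => hK.matrix_elem i j
  rw [intervalIntegral_apply (hKf.intervalIntegrable _ _),
    ← intervalIntegral.integral_finsetSum fun j _ =>
      Continuous.intervalIntegrable (by fun_prop) _ _]
  simp only [mulVec, dotProduct, mul_comm]

theorem aemeasurable_variationOfConstants (hW : IsBrownianVec W P) {b : ℝ → Fin n → ℝ}
    (hb : IntervalIntegrable b volume 0 T) {t : ℝ} (ht : t ∈ Icc 0 T) :
    AEMeasurable (fun ω => variationOfConstants A x₀ b (noisePath Sig W ω) t) P := by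
  have hΨ := continuous_transition_right A 0
  have hbt : IntervalIntegrable b volume 0 t :=
    hb.mono_set (uIcc_subset_uIcc left_mem_uIcc (Icc_subset_uIcc ht))
  have hNt : AEMeasurable (fun ω => noisePath Sig W ω t) P := by
    have h1 : AEMeasurable (fun ω => fun j => W j t.toNNReal ω) P :=
      aemeasurable_pi_lambda _ fun j => (hW.isBrownian j).aemeasurable _
    have h2 : Continuous fun v : Fin n → ℝ => (open scoped MatrixOrder in CFC.sqrt Sig) *ᵥ v :=
      continuous_const.matrix_mulVec continuous_id
    exact h2.measurable.comp_aemeasurable h1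
  have hint : AEMeasurable (fun ω => ∫ s in (0 : ℝ)..t,
      transition A 0 s *ᵥ (A *ᵥ noisePath Sig W ω s + b s)) P := by
    refine aemeasurable_pi_lambda _ fun i => ?_
    set K : ℝ → Matrix (Fin n) (Fin n) ℝ := fun s =>
      transition A 0 s * A * (open scoped MatrixOrder in CFC.sqrt Sig) with hK
    have hKc : Continuous K := by fun_prop
    -- Only the noise part of the integral is random; the control contributes a constant.
    have hexp : AEMeasurable (fun ω => (∑ j, ∫ s in (0 : ℝ)..t, W j s.toNNReal ω * K s i j) +
        (∫ s in (0 : ℝ)..t, transition A 0 s *ᵥ b s) i) P :=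
      (Finset.aemeasurable_fun_sum _ fun j _ =>
        hW.aemeasurable_integral_mul ht.1 (hKc.matrix_elem i j) j).add_const _
    refine hexp.congr ?_
    filter_upwards [hW.ae_continuous] with ω hω
    have hWc : Continuous fun s : ℝ => fun j => W j s.toNNReal ω :=
      continuous_pi fun j => (hω j).comp continuous_real_toNNReal
    rw [← mulVec_integral_eq_sum hKc hWc, ← Pi.add_apply, ← intervalIntegral.integral_add
      ((hKc.matrix_mulVec hWc).intervalIntegrable _ _)
      (intervalIntegrable_mulVec (fun i j => (hΨ.matrix_elem i j).continuousOn) hbt)]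
    simp only [hK, noisePath, mulVec_add, mulVec_mulVec, Matrix.mul_assoc]
  have hc : Continuous fun v : Fin n → ℝ => transition A t 0 *ᵥ (x₀ + v) :=
    continuous_const.matrix_mulVec (continuous_const.add continuous_id)
  exact (hc.measurable.comp_aemeasurable hint).add hNt

theorem intervalIntegrable_of_memLp (hT : 0 ≤ T) (hu : MemLp u 2 (volume.restrict (Icc 0 T))) :
    IntervalIntegrable u volume 0 T := by
  rw [intervalIntegrable_iff_integrableOn_Icc_of_le hT]
  exact hu.integrable (by norm_num)

/-- Existence keeps the quantification over all solutions in `HalfspaceProb` from being vacuous. -/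
theorem exists_isSolution (hW : IsBrownianVec W P) (hT : 0 ≤ T)
    (hu : IntervalIntegrable u volume 0 T) : ∃ X, IsSolution A B Sig x₀ T W P u X := by
  have hb : IntervalIntegrable (fun s => B *ᵥ u s) volume 0 T :=
    intervalIntegrable_mulVec (Φ := fun _ => B) (fun _ _ => continuousOn_const) hu
  refine ⟨fun t ω => variationOfConstants A x₀ (fun s => B *ᵥ u s) (noisePath Sig W ω) t,
    fun t ht => aemeasurable_variationOfConstants hW hb ht, ?_, ?_⟩
  · filter_upwards [hW.ae_continuous] with ω hω
    rw [← uIcc_of_le hT]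
    exact continuousOn_variationOfConstants x₀ (continuous_noisePath hω).continuousOn hb
  · filter_upwards [hW.ae_continuous] with ω hω t ht
    exact variationOfConstants_eq x₀ (continuous_noisePath hω).continuousOn hb
      (Icc_subset_uIcc ht)

theorem hasLaw_terminalNoise [IsProbabilityMeasure P] (hSig : Sig.PosDef)
    (hW : IsBrownianVec W P) (hT : 0 ≤ T) :
    HasLaw (terminalNoise A Sig T w W)
      (gaussianReal 0 (w ⬝ᵥ (noiseCov A Sig T *ᵥ w)).toNNReal) P := by
  have h := hasLaw_sum_wienerIntegral hW hT (fun j s => hasDerivAt_noiseFilter (A := A)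
    (Sig := Sig) (T := T) (w := w) j s) continuous_noiseFilterDeriv
  have hc : ∀ j, Continuous (noiseFilter A Sig T w j) := fun j =>
    continuous_iff_continuousAt.2 fun s => (hasDerivAt_noiseFilter j s).continuousAt
  rw [← intervalIntegral.integral_finsetSum fun j _ =>
    Continuous.intervalIntegrable (by fun_prop) _ _] at h
  simp only [sum_noiseFilter_sq hSig] at h
  rwa [dotProduct_noiseCov_mulVec]

/-- The mean of `wᵀ X_T` without control. -/
noncomputable def uncontrolledMean (A : Matrix (Fin n) (Fin n) ℝ) (x₀ w : Fin n → ℝ) (T : ℝ) : ℝ :=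
  w ⬝ᵥ (transition A T 0 *ᵥ x₀)

/-- The shift of the mean of `wᵀ X_T` produced by a control. -/
noncomputable def meanShift (A : Matrix (Fin n) (Fin n) ℝ) (B : Matrix (Fin n) (Fin m) ℝ) (T : ℝ)
    (w : Fin n → ℝ) (u : ℝ → Fin m → ℝ) : ℝ :=
  ∫ s in (0 : ℝ)..T, controlFilter A B T w s ⬝ᵥ u s

/-- The right side does not involve `X`, so all solutions give the same halfspace probability and no
separate uniqueness theorem is needed. -/
theorem IsSolution.dotProduct_terminal_ae_eq (hW : IsBrownianVec W P) (hT : 0 ≤ T)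
    (hu : IntervalIntegrable u volume 0 T) (hX : IsSolution A B Sig x₀ T W P u X) :
    ∀ᵐ ω ∂P, w ⬝ᵥ X T ω =
      uncontrolledMean A x₀ w T + meanShift A B T w u + terminalNoise A Sig T w W ω := by
  have hΨ := continuous_transition_right A T
  have hb : IntervalIntegrable (fun s => B *ᵥ u s) volume 0 T :=
    intervalIntegrable_mulVec (Φ := fun _ => B) (fun _ _ => continuousOn_const) hu
  filter_upwards [hW.ae_continuous, hX.continuousOn, hX.integral_eq] with ω hω hc heq
  rw [terminal_eq_of_integral_eq hT hc (continuous_noisePath hω).continuousOn hb heq,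
    dotProduct_add, dotProduct_add, terminalNoise_eq hω, intervalIntegral_dotProduct
      (intervalIntegrable_mulVec (fun i j => (hΨ.matrix_elem i j).continuousOn) hb)]
  simp only [uncontrolledMean, meanShift, controlFilter, mulVec_mulVec, dotProduct_mulVec,
    mulVec_transpose]

/-- The halfspace probability under an integrable control. -/
theorem halfspaceProb_iff [IsProbabilityMeasure P] (hSig : Sig.PosDef) (hW : IsBrownianVec W P)
    (hT : 0 ≤ T) (hv : 0 < w ⬝ᵥ (noiseCov A Sig T *ᵥ w))
    (hu : IntervalIntegrable u volume 0 T) {p : ℝ} :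
    HalfspaceProb A B Sig x₀ T W P w a u p ↔
      cdf (gaussianReal 0 1) ((uncontrolledMean A x₀ w T + meanShift A B T w u - a) /
        √(w ⬝ᵥ (noiseCov A Sig T *ᵥ w))) = p := by
  have hprob : ∀ X, IsSolution A B Sig x₀ T W P u X → P.real {ω | a ≤ w ⬝ᵥ X T ω} =
      cdf (gaussianReal 0 1) ((uncontrolledMean A x₀ w T + meanShift A B T w u - a) /
        √(w ⬝ᵥ (noiseCov A Sig T *ᵥ w))) := by
    intro X hX
    rw [← measureReal_le_add_gaussian hv (hasLaw_terminalNoise hSig hW hT)]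
    refine measureReal_congr ?_
    filter_upwards [hX.dotProduct_terminal_ae_eq (w := w) hW hT hu] with ω hω
    exact congrArg (a ≤ ·) hω
  obtain ⟨X, hX⟩ := exists_isSolution (A := A) (B := B) (Sig := Sig) (x₀ := x₀) hW hT hu
  exact ⟨fun h => (hprob X hX).symm.trans (h.2 X hX),
    fun h => ⟨⟨X, hX⟩, fun Y hY => (hprob Y hY).trans h⟩⟩

end Solutions

end QuantileEnergy

namespace QuantileEnergy

/-! ### The effort lower bound and its equality case -/

section Effort

variable {n m : ℕ} {A Sig : Matrix (Fin n) (Fin n) ℝ} {B : Matrix (Fin n) (Fin m) ℝ}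
  {w : Fin n → ℝ} {T : ℝ} {u : ℝ → Fin m → ℝ}

/-- The filter `M⁺ Bᵀ Ψ(T,s)ᵀ w`, which is the matched-filter control up to the gain. -/
noncomputable def matchedDirection (A : Matrix (Fin n) (Fin n) ℝ) (B : Matrix (Fin n) (Fin m) ℝ)
    (Sig : Matrix (Fin n) (Fin n) ℝ) (T : ℝ) (w : Fin n → ℝ) (s : ℝ) : Fin m → ℝ :=
  pinv (effortWeight B Sig) *ᵥ controlFilter A B T w s

theorem matchedFilter_eq (p₀ p₁ : ℝ) :
    matchedFilter A B Sig T w p₀ p₁ =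
      fun s => gain A B Sig T w p₀ p₁ • matchedDirection A B Sig T w s := by
  funext s
  simp only [matchedFilter, matchedDirection, controlFilter, mulVec_mulVec, transpose_mul,
    Matrix.mul_assoc]

theorem continuous_matchedDirection : Continuous (matchedDirection A B Sig T w) :=
  continuous_const.matrix_mulVec (continuous_controlFilter A B T w)

/-- This is where a singular `M` does no harm: the filter lies in the range of `Bᵀ`, on which `M M⁺`
is the identity. -/
theorem effortWeight_mulVec_matchedDirection (hSig : Sig.PosDef) (s : ℝ) :
    effortWeight B Sig *ᵥ matchedDirection A B Sig T w s = controlFilter A B T w s := by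
  have h := effortWeight_mul_pinv_mul_transpose B hSig
  simp only [matchedDirection, controlFilter, transpose_mul]
  rw [← mulVec_mulVec w Bᵀ, mulVec_mulVec, mulVec_mulVec, h]

theorem memLp_two_of_continuous (hu : Continuous u) : MemLp u 2 (volume.restrict (Icc 0 T)) := by
  obtain ⟨C, hC⟩ := isCompact_Icc.exists_bound_of_continuousOn (hu.continuousOn (s := Icc 0 T))
  exact MemLp.of_bound hu.aestronglyMeasurable C
    ((ae_restrict_iff' measurableSet_Icc).2 (ae_of_all _ hC))

theorem meanShift_smul_matchedDirection (β : ℝ) :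
    meanShift A B T w (fun s => β • matchedDirection A B Sig T w s) =
      β * (w ⬝ᵥ (gramian A B Sig T *ᵥ w)) := by
  simp only [meanShift, dotProduct_gramian_mulVec, matchedDirection, dotProduct_smul, smul_eq_mul,
    intervalIntegral.integral_const_mul]

theorem effort_smul_matchedDirection (hSig : Sig.PosDef) (β : ℝ) :
    effort B Sig T (fun s => β • matchedDirection A B Sig T w s) =
      β ^ 2 * (w ⬝ᵥ (gramian A B Sig T *ᵥ w)) / 2 := by
  have h : ∀ s, (β • matchedDirection A B Sig T w s) ⬝ᵥ
      (effortWeight B Sig *ᵥ (β • matchedDirection A B Sig T w s)) =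
      β ^ 2 * (controlFilter A B T w s ⬝ᵥ
        (pinv (effortWeight B Sig) *ᵥ controlFilter A B T w s)) := by
    intro s
    rw [mulVec_smul, effortWeight_mulVec_matchedDirection hSig, smul_dotProduct, dotProduct_smul,
      dotProduct_comm, smul_eq_mul, smul_eq_mul, matchedDirection]
    ring
  simp only [effort, h, intervalIntegral.integral_const_mul, dotProduct_gramian_mulVec]
  ring

theorem dotProduct_effortWeight_comm (hSig : Sig.PosDef) (x y : Fin m → ℝ) :
    x ⬝ᵥ (effortWeight B Sig *ᵥ y) = y ⬝ᵥ (effortWeight B Sig *ᵥ x) := by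
  rw [dotProduct_mulVec, ← mulVec_transpose, effortWeight_transpose B hSig, dotProduct_comm]

theorem intervalIntegrable_effort (hT : 0 ≤ T) (hu : MemLp u 2 (volume.restrict (Icc 0 T))) :
    IntervalIntegrable (fun s => u s ⬝ᵥ (effortWeight B Sig *ᵥ u s)) volume 0 T := by
  rw [intervalIntegrable_iff_integrableOn_Icc_of_le hT]
  simp only [dotProduct, mulVec, Finset.mul_sum]
  refine integrable_finsetSum _ fun i _ => integrable_finsetSum _ fun j _ => ?_
  have h := ((hu.eval i).integrable_mul (hu.eval j)).const_mul (effortWeight B Sig i j)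
  refine h.congr (ae_of_all _ fun s => ?_)
  simp only [Pi.mul_apply]
  ring

theorem intervalIntegrable_controlFilter_dotProduct (hu : IntervalIntegrable u volume 0 T) :
    IntervalIntegrable (fun s => controlFilter A B T w s ⬝ᵥ u s) volume 0 T := by
  have : (fun s => controlFilter A B T w s ⬝ᵥ u s) =
      ∑ j, fun s => controlFilter A B T w s j * u s j := by
    ext s; simp [dotProduct]
  rw [this]
  exact IntervalIntegrable.sum _ fun j _ => (intervalIntegrable_pi_iff.1 hu j).continuousOn_mul
    ((continuous_apply j).comp (continuous_controlFilter A B T w)).continuousOn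

/-- Completing the square: a lower bound for the effort in terms of the mean shift. -/
theorem mul_meanShift_sub_le_effort (hSig : Sig.PosDef) (hT : 0 ≤ T)
    (hu : MemLp u 2 (volume.restrict (Icc 0 T))) (β : ℝ) :
    β * meanShift A B T w u - β ^ 2 * (w ⬝ᵥ (gramian A B Sig T *ᵥ w)) / 2 ≤ effort B Sig T u := by
  -- The square is completed around `d` because `M d` is `β` times the control filter, so the cross
  -- term depends on `u` only through its mean shift.
  set d := fun s => β • matchedDirection A B Sig T w s with hd
  have hdc : Continuous d := continuous_matchedDirection.const_smul β
  have hexp : ∀ s, (u s - d s) ⬝ᵥ (effortWeight B Sig *ᵥ (u s - d s)) =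
      u s ⬝ᵥ (effortWeight B Sig *ᵥ u s) - 2 * β * (controlFilter A B T w s ⬝ᵥ u s) +
        d s ⬝ᵥ (effortWeight B Sig *ᵥ d s) := by
    intro s
    have hcross : u s ⬝ᵥ (effortWeight B Sig *ᵥ d s) =
        β * (controlFilter A B T w s ⬝ᵥ u s) := by
      simp only [hd]
      rw [mulVec_smul, effortWeight_mulVec_matchedDirection hSig, dotProduct_smul, smul_eq_mul,
        dotProduct_comm]
    rw [mulVec_sub, sub_dotProduct, dotProduct_sub, dotProduct_sub,
      dotProduct_effortWeight_comm hSig (d s) (u s), hcross]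
    ring
  have hpos : 0 ≤ ∫ s in (0 : ℝ)..T, (u s - d s) ⬝ᵥ (effortWeight B Sig *ᵥ (u s - d s)) :=
    intervalIntegral.integral_nonneg hT fun s _ => dotProduct_effortWeight_nonneg B hSig _
  have hi1 := intervalIntegrable_effort (B := B) (Sig := Sig) hT hu
  have hi2 := (intervalIntegrable_controlFilter_dotProduct (A := A) (B := B) (w := w)
    (intervalIntegrable_of_memLp hT hu)).const_mul (2 * β)
  have hi3 := intervalIntegrable_effort (B := B) (Sig := Sig) hT (memLp_two_of_continuous hdc)
  simp only [hexp] at hpos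
  rw [intervalIntegral.integral_add (hi1.sub hi2) hi3, intervalIntegral.integral_sub hi1 hi2,
    intervalIntegral.integral_const_mul] at hpos
  have hde := effort_smul_matchedDirection (A := A) (B := B) (T := T) (w := w) hSig β
  simp only [effort] at hde ⊢
  simp only [meanShift]
  linarith

end Effort

end QuantileEnergy

/-! ### The minimum effort theorem -/

theorem theorem1 {n m : ℕ}
    (A : Matrix (Fin n) (Fin n) ℝ) (B : Matrix (Fin n) (Fin m) ℝ)
    (Sig : Matrix (Fin n) (Fin n) ℝ) (hSig : Sig.PosDef)
    (x₀ : Fin n → ℝ) (T : ℝ) (hT : 0 < T) (w : Fin n → ℝ) (a : ℝ)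
    (hw : 0 < w ⬝ᵥ (QuantileEnergy.gramian A B Sig T *ᵥ w))
    {Ω : Type*} [MeasurableSpace Ω] (P : Measure Ω) [IsProbabilityMeasure P]
    (W : Fin n → ℝ≥0 → Ω → ℝ) (hW : QuantileEnergy.IsBrownianVec W P) :
    ∃ p₀ ∈ Ioo (0 : ℝ) 1, QuantileEnergy.HalfspaceProb A B Sig x₀ T W P w a 0 p₀ ∧
      ∀ p₁ ∈ Ioo (0 : ℝ) 1,
        IsLeast (QuantileEnergy.effort B Sig T ''
            QuantileEnergy.feasible A B Sig x₀ T W P w a p₁)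
          ((QuantileEnergy.stdNormalQuantile p₁ - QuantileEnergy.stdNormalQuantile p₀) ^ 2 /
            (2 * QuantileEnergy.ratio A B Sig T w)) ∧
        QuantileEnergy.matchedFilter A B Sig T w p₀ p₁ ∈
          QuantileEnergy.feasible A B Sig x₀ T W P w a p₁ ∧
        QuantileEnergy.effort B Sig T (QuantileEnergy.matchedFilter A B Sig T w p₀ p₁) =
          (QuantileEnergy.stdNormalQuantile p₁ - QuantileEnergy.stdNormalQuantile p₀) ^ 2 /
            (2 * QuantileEnergy.ratio A B Sig T w) := by
  open QuantileEnergy in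
  have hw0 : w ≠ 0 := by
    rintro rfl
    simp at hw
  have hv := dotProduct_noiseCov_mulVec_pos A hSig hT hw0
  set G := w ⬝ᵥ (gramian A B Sig T *ᵥ w) with hG
  set v := w ⬝ᵥ (noiseCov A Sig T *ᵥ w) with hvdef
  have hs : 0 < √v := Real.sqrt_pos.2 hv
  -- The standardized uncontrolled margin, which is `Φ⁻¹(p₀)`.
  set q₀ := (uncontrolledMean A x₀ w T - a) / √v with hq₀
  refine ⟨cdf (gaussianReal 0 1) q₀, cdf_stdNormal_mem_Ioo _, ?_, fun p₁ hp₁ => ?_⟩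
  · refine (halfspaceProb_iff hSig hW hT.le hv (u := 0)
      (by exact intervalIntegrable_const (c := (0 : Fin m → ℝ)))).2 ?_
    simp [meanShift, hq₀, hvdef]
  rw [stdNormalQuantile_cdf]
  set p₀ := cdf (gaussianReal 0 1) q₀ with hp₀
  set q₁ := stdNormalQuantile p₁ with hq₁
  -- Injectivity of `Φ` turns the probability constraint into a linear equation for the mean shift.
  have hfeas : ∀ u : ℝ → Fin m → ℝ, MemLp u 2 (volume.restrict (Icc 0 T)) →
      (HalfspaceProb A B Sig x₀ T W P w a u p₁ ↔ meanShift A B T w u = (q₁ - q₀) * √v) := by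
    intro u hu
    rw [halfspaceProb_iff hSig hW hT.le hv (intervalIntegrable_of_memLp hT.le hu),
      cdf_stdNormal_eq_iff hp₁, ← hq₁, ← hvdef, hq₀, div_eq_iff hs.ne', sub_mul,
      div_mul_cancel₀ _ hs.ne']
    constructor <;> intro h <;> linarith
  set β := gain A B Sig T w p₀ p₁ with hβ
  have hβG : β * G = (q₁ - q₀) * √v := by
    rw [hβ, gain, ← hG, ← hvdef, hp₀, stdNormalQuantile_cdf, div_mul_cancel₀ _ hw.ne']
  have hval : (q₁ - q₀) ^ 2 / (2 * ratio A B Sig T w) = β ^ 2 * G / 2 := by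
    have hsq : (β * G) ^ 2 = (q₁ - q₀) ^ 2 * v := by
      rw [hβG, mul_pow, Real.sq_sqrt hv.le]
    rw [ratio, ← hG, ← hvdef]
    field_simp
    linarith
  have hmf := matchedFilter_eq (A := A) (B := B) (Sig := Sig) (T := T) (w := w) p₀ p₁
  rw [← hβ] at hmf
  have hmem : matchedFilter A B Sig T w p₀ p₁ ∈ feasible A B Sig x₀ T W P w a p₁ := by
    have hL : MemLp (matchedFilter A B Sig T w p₀ p₁) 2 (volume.restrict (Icc 0 T)) := by
      rw [hmf]
      exact memLp_two_of_continuous (continuous_matchedDirection.const_smul β)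
    refine ⟨hL, (hfeas _ hL).2 ?_⟩
    rw [hmf, meanShift_smul_matchedDirection, ← hG, hβG]
  have heff : effort B Sig T (matchedFilter A B Sig T w p₀ p₁) =
      (q₁ - q₀) ^ 2 / (2 * ratio A B Sig T w) := by
    rw [hmf, effort_smul_matchedDirection hSig, ← hG, hval]
  refine ⟨⟨⟨_, hmem, heff⟩, ?_⟩, hmem, heff⟩
  rintro _ ⟨u, ⟨hu, hup⟩, rfl⟩
  -- For feasible `u` the mean shift is `β G`, so with this `β` the bound reads `β² G - β² G / 2 =
  -- β² G / 2`, the effort of the matched filter.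
  have h := mul_meanShift_sub_le_effort (A := A) (B := B) (w := w) hSig hT.le hu β
  rw [(hfeas u hu).1 hup, ← hβG, ← hG] at h
  rw [hval]
  linarith
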